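/- All graphs are finite and simple. For a graph $G$ with vertex $v$, the graph $G-v$ is called a card of $G$; the deck of $G$ is the multiset of the isomorphism classes of all its cards, and $b(G,H)$ is the cardinality of the multiset intersection of the decks of $G$ and $H$. The skeleton of $G$ is the graph obtained by deleting all leaves and isolated vertices of $G$. A sunshine graph is a connected graph whose skeleton is a cycle, and a caterpillar is a connected graph whose skeleton is a path. Let $n \ge 14$, let $U$ be a sunshine graph and $T$ a caterpillar, both of order $n$, and let $U^+$ be a sunshine graph with a leaf $w$ and a vertex $v$ on its cycle such that $U^+-w \cong U$ and $U^+-v \cong T$. Label the skeleton of $U^+$ as the cycle $x_0x_1\ldots x_{c-1}x_0$ (indices modulo $c$) so that $x_0$ is the neighbour of $w$, $v = x_\nu$ with $1 \le \nu \le c-1$, and $d(x_{\nu-1}) \ge d(x_{\nu+1})$, where $d$ denotes degree in $U^+$. Consider the following structures of $U^+$, where $0 \le i \le c-1$: - (S0a) $n \equiv 2 \pmod 3$; $d(x_i)=3$ if $i \equiv 0 \pmod 2$ and $d(x_i)=2$ otherwise; $\nu \equiv 1 \pmod 2$. - (S0b) $n \equiv 6 \pmod 7$; $d(x_i)=4$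 if $i \equiv 0 \pmod 4$, $d(x_i)=3$ if $i \equiv 2 \pmod 4$, and $d(x_i)=2$ otherwise; $\nu \equiv 1 \pmod 4$. - (S1a) $n \equiv 3 \pmod 4$; $d(x_i)=3$ if $i \equiv 0 \pmod 3$ and $d(x_i)=2$ otherwise; $\nu \equiv 1 \pmod 3$. - (S1b) $n \equiv 4 \pmod 5$; $d(x_i)=4$ if $i \equiv 0 \pmod 3$ and $d(x_i)=2$ otherwise; $\nu \equiv 1 \pmod 3$. - (S2a) $n \equiv 4 \pmod 5$; $d(x_i)=3$ if $i \equiv 0 \pmod 4$ and $d(x_i)=2$ otherwise; $\nu \equiv 2 \pmod 4$. - (S2b) $n \equiv 6 \pmod 7$; $d(x_i)=4$ if $i \equiv 0 \pmod 5$ and $d(x_i)=2$ otherwise; $\nu \equiv 2$ or $3 \pmod 5$. Then: (a) if $U^+$ has structure (S0a), then $b(U,T) = \frac{n+1}{3}+2$; (b) if $U^+$ has structure (S0b), then $b(U,T) = \frac{2(n+1)}{7}+1$; (c) if $U^+$ has structure (S1a), then $b(U,T) = \frac{n+1}{4}+1$; (d) if $U^+$ has structure (S1b), then $b(U,T) =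 \frac{2(n+1)}{5}$; (e) if $U^+$ has structure (S2a), then $b(U,T) = \frac{n+1}{5}$; (f) if $U^+$ has structure (S2b), then $b(U,T) = \frac{2(n+1)}{7}$. -/

import Mathlib

universe u

namespace SunCat

/-! ### Decks and common cards -/

/-- The card `G - v`: the subgraph of `G` obtained by deleting the vertex `v`. -/
abbrev card {V : Type u} (G : SimpleGraph V) (v : V) : SimpleGraph ↥({v}ᶜ : Set V) :=
  G.induce ({v}ᶜ : Set V)

/-- Isomorphism, as an equivalence relation on graphs. -/
instance graphSetoid : Setoid (Σ V : Type u, SimpleGraph V) where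
  r G H := Nonempty (G.2 ≃g H.2)
  iseqv :=
    { refl := fun _ => ⟨SimpleGraph.Iso.refl⟩
      symm := fun ⟨e⟩ => ⟨e.symm⟩
      trans := fun ⟨e⟩ ⟨f⟩ => ⟨e.trans f⟩ }

/-- Unlabelled graphs, i.e. isomorphism classes of graphs. -/
def UnlabelledGraph : Type (u + 1) := Quotient graphSetoid.{u}

/-- The isomorphism class of a graph. -/
def unlabelled {V : Type u} (G : SimpleGraph V) : UnlabelledGraph.{u} :=
  Quotient.mk graphSetoid ⟨V, G⟩

/-- The deck of `G`: the multiset of all its unlabelled cards, one for each vertex. -/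
def deck {V : Type u} [Fintype V] (G : SimpleGraph V) : Multiset UnlabelledGraph.{u} :=
  (Finset.univ : Finset V).val.map fun v => unlabelled (card G v)

open Classical in
/-- `b(G, H)`: the cardinality of the multiset intersection of the decks of `G` and `H`. -/
noncomputable def numCommonCards {V W : Type u} [Fintype V] [Fintype W]
    (G : SimpleGraph V) (H : SimpleGraph W) : ℕ :=
  Multiset.card (deck G ∩ deck H)

/-! ### Sunshine graphs and caterpillars -/

/-- The vertices of the skeleton: those that are neither leaves nor isolated. -/
def skelVerts {V : Type u} [Fintype V] (G : SimpleGraph V) [DecidableRel G.Adj] : Set V :=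
  {v | G.degree v ≠ 0 ∧ G.degree v ≠ 1}

/-- The skeleton of `G`: delete all leaves and isolated vertices. -/
def skel {V : Type u} [Fintype V] (G : SimpleGraph V) [DecidableRel G.Adj] :
    SimpleGraph ↥(skelVerts G) :=
  G.induce (skelVerts G)

/-- A sunshine graph is a connected graph whose skeleton is a cycle. -/
def IsSunshine {V : Type u} [Fintype V] (G : SimpleGraph V) [DecidableRel G.Adj] : Prop :=
  G.Connected ∧ ∃ c : ℕ, 3 ≤ c ∧ Nonempty (skel G ≃g SimpleGraph.cycleGraph c)

/-- A caterpillar is a connected graph whose skeleton is a path. -/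
def IsCaterpillar {V : Type u} [Fintype V] (G : SimpleGraph V) [DecidableRel G.Adj] : Prop :=
  G.Connected ∧ ∃ p : ℕ, 1 ≤ p ∧ Nonempty (skel G ≃g SimpleGraph.pathGraph p)

/-! ### The labelling of the supercard -/

/-- The labelling of a sunshine graph `G` relative to a leaf `w` and a cycle vertex `x ν`:
the skeleton of `G` is the cycle `x 0, x 1, …, x (c - 1), x 0`, with indices read modulo `c`,
the vertex `x 0` is the neighbour of the leaf `w`, `1 ≤ ν ≤ c - 1`, and the cycle is directed
so that `x (ν - 1)` has degree at least that of `x (ν + 1)`. -/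
structure IsLabelling {V : Type u} [Fintype V] (G : SimpleGraph V) [DecidableRel G.Adj]
    (w : V) (c : ℕ) (x : ℤ → V) (ν : ℤ) : Prop where
  three_le : 3 ≤ c
  eq_iff : ∀ i j : ℤ, x i = x j ↔ i ≡ j [ZMOD c]
  range_eq : Set.range x = skelVerts G
  adj_iff : ∀ i j : ℤ, G.Adj (x i) (x j) ↔ (j ≡ i + 1 [ZMOD c] ∨ i ≡ j + 1 [ZMOD c])
  leaf : G.degree w = 1
  adj_leaf : G.Adj (x 0) w
  one_le_nu : 1 ≤ ν
  nu_lt : ν < c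
  degree_le : G.degree (x (ν + 1)) ≤ G.degree (x (ν - 1))

/-! ### The six structures -/

section Structures

variable {V : Type u} [Fintype V] (G : SimpleGraph V) [DecidableRel G.Adj]
  (n c : ℕ) (x : ℤ → V) (ν : ℤ)

/-- Structure (S0a). -/
def StructureS0a : Prop :=
  n ≡ 2 [MOD 3] ∧
  (∀ i : ℤ, 0 ≤ i → i < c → G.degree (x i) = if i ≡ 0 [ZMOD 2] then 3 else 2) ∧
  ν ≡ 1 [ZMOD 2]

/-- Structure (S0b). -/
def StructureS0b : Prop :=
  n ≡ 6 [MOD 7] ∧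
  (∀ i : ℤ, 0 ≤ i → i < c →
    G.degree (x i) = if i ≡ 0 [ZMOD 4] then 4 else if i ≡ 2 [ZMOD 4] then 3 else 2) ∧
  ν ≡ 1 [ZMOD 4]

/-- Structure (S1a). -/
def StructureS1a : Prop :=
  n ≡ 3 [MOD 4] ∧
  (∀ i : ℤ, 0 ≤ i → i < c → G.degree (x i) = if i ≡ 0 [ZMOD 3] then 3 else 2) ∧
  ν ≡ 1 [ZMOD 3]

/-- Structure (S1b). -/
def StructureS1b : Prop :=
  n ≡ 4 [MOD 5] ∧
  (∀ i : ℤ, 0 ≤ i → i < c → G.degree (x i) = if i ≡ 0 [ZMOD 3] then 4 else 2) ∧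
  ν ≡ 1 [ZMOD 3]

/-- Structure (S2a). -/
def StructureS2a : Prop :=
  n ≡ 4 [MOD 5] ∧
  (∀ i : ℤ, 0 ≤ i → i < c → G.degree (x i) = if i ≡ 0 [ZMOD 4] then 3 else 2) ∧
  ν ≡ 2 [ZMOD 4]

/-- Structure (S2b). -/
def StructureS2b : Prop :=
  n ≡ 6 [MOD 7] ∧
  (∀ i : ℤ, 0 ≤ i → i < c → G.degree (x i) = if i ≡ 0 [ZMOD 5] then 4 else 2) ∧
  (ν ≡ 2 [ZMOD 5] ∨ ν ≡ 3 [ZMOD 5])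

end Structures

end SunCat

/-! Write G for U⁺. A card of U is G with w and some u deleted; a card of T is G with `x ν` and some
t deleted. Hence b(U, T) is the maximum size of a matching between such u and t whose deleted pairs
leave isomorphic graphs. As in König's theorem, a matching is certified maximum by choosing one
endpoint of each matched pair so that the chosen vertices cover every coincidence
(`card_inter_map_eq`, `numCommonCards_eq`).

Lower bound. The congruence on n forces the cycle to have p * k vertices, with degrees of period p
and symmetric about `x 0`. Rotations by multiples of p and the reflection about `x 0` then extend to
automorphisms of G (`IsSun.exists_aut`). They match u = `x (ν - m)` and u = `x (m - ν)` with a leaf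
t at `x m`, for p ∣ m. One leaf at each such `x m` yields k common cards; two leaves, with ν and -ν
distinct modulo p, yield 2k. The extra summands 2, 1, 1 for `StructureS0a`, `StructureS0b`,
`StructureS1a` come from twins: `x 1` has degree two, so without `x 2` it hangs at `x 0` exactly as
w does (`pairCard_two`). This matches `x 2` or `x (-2)` with neighbours of `x ν`.

Upper bound. Other coincidences are excluded by invariants: the number of edges
(`cases_of_pairCard_eq`), isolated vertices (`eq_of_pairCard_eq_of_leaf`), and vertices of maximum
degree (`pairCard_ne_of_lostVerts`). When `x ν` is at distance two from the nearest leaf-bearing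
vertex, finer local data are needed (`eq_of_end`, `pairDeg_ne_three`). -/

namespace SunCat

/-! ### Multiset intersections of images -/

/-- If `p`, `q` match elements with equal images, and every coincidence `f a = g b` is covered
by one chosen endpoint of a matched pair, then the images of `f` and `g` have exactly as many
common elements as there are matched pairs. -/
theorem card_inter_map_eq {α β γ ι : Type*} [Fintype α] [Fintype β] [Fintype ι] [DecidableEq γ]
    (f : α → γ) (g : β → γ) (p : ι → α) (q : ι → β)
    (hp : Function.Injective p) (hq : Function.Injective q) (hm : ∀ j, f (p j) = g (q j))
    (P : ι → Prop) (hc : ∀ a b, f a = g b → ∃ j, p j = a ∧ P j ∨ q j = b ∧ ¬ P j) :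
    Multiset.card ((Finset.univ : Finset α).val.map f ∩ (Finset.univ : Finset β).val.map g) =
      Fintype.card ι := by
  classical
  apply le_antisymm
  · set A := (Finset.univ : Finset α).val.map f
    set B := (Finset.univ : Finset β).val.map g
    -- Common classes are split by which side covers them. If `Q z` fails, some preimage of z under
    -- f is not a chosen endpoint, so every preimage under g must be one.
    let Q : γ → Prop := fun z => ∀ a, f a = z → ∃ j, p j = a ∧ P j
    have h1 : Multiset.card ((A ∩ B).filter Q) ≤ (Finset.univ.filter P).card := by
      have h : (A ∩ B).filter Q ≤ A.filter Q := Multiset.filter_le_filter _ inf_le_left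
      refine (Multiset.card_le_card h).trans ?_
      rw [Multiset.filter_map, Multiset.card_map]
      change (Finset.univ.filter (Q ∘ f)).card ≤ _
      refine (Finset.card_le_card (t := (Finset.univ.filter P).image p) ?_).trans
        Finset.card_image_le
      intro a ha
      obtain ⟨j, h1, h2⟩ := (Finset.mem_filter.1 ha).2 a rfl
      exact Finset.mem_image.2 ⟨j, by simpa using h2, h1⟩
    have h2 : Multiset.card ((A ∩ B).filter fun z => ¬ Q z) ≤
        (Finset.univ.filter fun j => ¬ P j).card := by
      have h : (A ∩ B).filter (fun z => ¬ Q z) ≤ B.filter fun z => ¬ Q z :=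
        Multiset.filter_le_filter _ inf_le_right
      refine (Multiset.card_le_card h).trans ?_
      rw [Multiset.filter_map, Multiset.card_map]
      change (Finset.univ.filter ((fun z => ¬ Q z) ∘ g)).card ≤ _
      refine (Finset.card_le_card (t := (Finset.univ.filter fun j => ¬ P j).image q) ?_).trans
        Finset.card_image_le
      intro b hb
      have hb' : ¬ Q (g b) := (Finset.mem_filter.1 hb).2
      simp only [Q, not_forall] at hb'
      obtain ⟨a, hab, hna⟩ := hb'
      obtain ⟨j, h | h⟩ := hc a b hab
      · exact absurd ⟨j, h⟩ hna
      · exact Finset.mem_image.2 ⟨j, by simpa using h.2, h.1⟩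
    have h3 := congrArg Multiset.card (Multiset.filter_add_not Q (A ∩ B))
    rw [Multiset.card_add] at h3
    have h4 := Finset.card_filter_add_card_filter_not (s := (Finset.univ : Finset ι)) P
    rw [Finset.card_univ] at h4
    omega
  · have hA : (Finset.univ : Finset ι).val.map (fun j => f (p j)) ≤
        (Finset.univ : Finset α).val.map f := by
      have := Multiset.map_le_map (f := f)
        (Finset.val_le_iff.2 (Finset.subset_univ (Finset.univ.map ⟨p, hp⟩)))
      simpa [Finset.map_val, Multiset.map_map] using this
    have hB : (Finset.univ : Finset ι).val.map (fun j => f (p j)) ≤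
        (Finset.univ : Finset β).val.map g := by
      have := Multiset.map_le_map (f := g)
        (Finset.val_le_iff.2 (Finset.subset_univ (Finset.univ.map ⟨q, hq⟩)))
      simpa [Finset.map_val, Multiset.map_map, Function.comp_def, hm] using this
    have := Multiset.card_le_card (le_inf hA hB)
    simpa using this

/-! ### Decks of cards -/

theorem unlabelled_eq_iff {V W : Type u} {G : SimpleGraph V} {H : SimpleGraph W} :
    unlabelled G = unlabelled H ↔ Nonempty (G ≃g H) :=
  Quotient.eq (r := graphSetoid)

/-- A bijection of vertices that preserves adjacency outside two deleted sets. -/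
def isoInduceCompl {V W : Type*} {G : SimpleGraph V} {H : SimpleGraph W} (e : V ≃ W)
    (s : Set V) (t : Set W) (hst : ∀ v, v ∈ s ↔ e v ∈ t)
    (hadj : ∀ u v, u ∉ s → v ∉ s → (H.Adj (e u) (e v) ↔ G.Adj u v)) :
    G.induce sᶜ ≃g H.induce tᶜ where
  toEquiv := e.subtypeEquiv fun v => by simp [hst]
  map_rel_iff' := by
    rintro ⟨u, hu⟩ ⟨v, hv⟩
    exact hadj u v hu hv

theorem deck_congr {V W : Type u} [Fintype V] [Fintype W] {G : SimpleGraph V}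
    {H : SimpleGraph W} (e : G ≃g H) : deck G = deck H := by
  unfold deck
  rw [← Multiset.map_univ_val_equiv e.toEquiv, Multiset.map_map]
  refine Multiset.map_congr rfl fun v _ => ?_
  refine unlabelled_eq_iff.2 ⟨isoInduceCompl e.toEquiv _ _ (fun u => ?_) fun u v _ _ => e.map_adj_iff⟩
  simp

/-- The isomorphism class of the graph obtained by deleting `a` and `b`. -/
def pairCard {V : Type u} (G : SimpleGraph V) (a b : V) : UnlabelledGraph.{u} :=
  unlabelled (G.induce ({a, b}ᶜ : Set V))

theorem pairCard_comm {V : Type u} (G : SimpleGraph V) (a b : V) :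
    pairCard G a b = pairCard G b a := by
  unfold pairCard
  rw [Set.pair_comm]

theorem pairCard_of_equiv {V : Type u} {G : SimpleGraph V} (e : V ≃ V) {a b a' b' : V}
    (hst : ∀ v, v ∈ ({a, b} : Set V) ↔ e v ∈ ({a', b'} : Set V))
    (hadj : ∀ u v, u ∉ ({a, b} : Set V) → v ∉ ({a, b} : Set V) →
      (G.Adj (e u) (e v) ↔ G.Adj u v)) :
    pairCard G a b = pairCard G a' b' :=
  unlabelled_eq_iff.2 ⟨isoInduceCompl e _ _ hst hadj⟩

theorem pairCard_aut {V : Type u} {G : SimpleGraph V} (e : G ≃g G) (a b : V) :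
    pairCard G a b = pairCard G (e a) (e b) :=
  pairCard_of_equiv e.toEquiv (fun v => by simp) fun _ _ _ _ => e.map_adj_iff

/-- If `a` and `a'` are nonadjacent twins after deleting `b`, deleting either is the same. -/
theorem pairCard_twin {V : Type u} {G : SimpleGraph V} {a a' b : V} (hab : a ≠ b) (hab' : a' ≠ b)
    (h : ∀ v, v ≠ b → (G.Adj a v ↔ G.Adj a' v)) :
    pairCard G a b = pairCard G a' b := by
  classical
  have hna : ¬ G.Adj a a' := fun h' => G.loopless.irrefl _ ((h a' hab').1 h')
  refine pairCard_of_equiv (Equiv.swap a a') (fun v => ?_) (fun u v hu hv => ?_)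
  · by_cases h1 : v = a
    · simp [h1]
    · by_cases h2 : v = a'
      · subst h2
        simp [h1, hab, hab', Ne.symm h1]
      · simp [Equiv.swap_apply_of_ne_of_ne h1 h2, h1, h2]
  · simp only [Set.mem_insert_iff, Set.mem_singleton_iff, not_or] at hu hv
    by_cases h1 : u = a'
    · subst h1
      by_cases h2 : v = u
      · simp [h2]
      · rw [Equiv.swap_apply_right, Equiv.swap_apply_of_ne_of_ne hv.1 h2]
        exact h v hv.2
    · rw [Equiv.swap_apply_of_ne_of_ne hu.1 h1]
      by_cases h2 : v = a'
      · subst h2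
        rw [Equiv.swap_apply_right, G.adj_comm, G.adj_comm u]
        exact h u hu.2
      · rw [Equiv.swap_apply_of_ne_of_ne hv.1 h2]

/-- The card of a card is the graph with two vertices deleted. -/
theorem unlabelled_card_card {V : Type u} (G : SimpleGraph V) (w : V) (v : ↥({w}ᶜ : Set V)) :
    unlabelled (card (card G w) v) = pairCard G w v := by
  refine unlabelled_eq_iff.2 ⟨⟨⟨fun z => ⟨z.1.1, ?_⟩, fun z => ⟨⟨z.1, ?_⟩, ?_⟩, ?_, ?_⟩, ?_⟩⟩
  · have h1 := z.1.2
    have h2 := z.2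
    simp only [Set.mem_compl_iff, Set.mem_singleton_iff] at h1 h2
    simp only [Set.mem_compl_iff, Set.mem_insert_iff, Set.mem_singleton_iff, not_or]
    exact ⟨h1, fun h => h2 (Subtype.ext h)⟩
  · have h1 := z.2
    simp only [Set.mem_compl_iff, Set.mem_insert_iff, Set.mem_singleton_iff, not_or] at h1
    exact h1.1
  · have h1 := z.2
    simp only [Set.mem_compl_iff, Set.mem_insert_iff, Set.mem_singleton_iff, not_or] at h1
    simp only [Set.mem_compl_iff, Set.mem_singleton_iff]
    exact fun h => h1.2 (congrArg Subtype.val h)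
  · intro z
    rfl
  · intro z
    rfl
  · intro a b
    rfl

/-- The common cards of two cards `G - a` and `G - b`, counted by a matching of deleted pairs. -/
theorem numCommonCards_eq {V VU VT : Type u} {ι : Type*} [Fintype VU] [Fintype VT] [Fintype V] [Fintype ι]
    {G : SimpleGraph V} {U : SimpleGraph VU} {T : SimpleGraph VT} {a b : V}
    (hU : Nonempty (card G a ≃g U)) (hT : Nonempty (card G b ≃g T))
    (p q : ι → V) (hpa : ∀ j, p j ≠ a) (hqb : ∀ j, q j ≠ b)
    (hp : Function.Injective p) (hq : Function.Injective q)
    (hm : ∀ j, pairCard G a (p j) = pairCard G b (q j))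
    (P : ι → Prop)
    (hc : ∀ u t, u ≠ a → t ≠ b → pairCard G a u = pairCard G b t →
      ∃ j, p j = u ∧ P j ∨ q j = t ∧ ¬ P j) :
    numCommonCards U T = Fintype.card ι := by
  classical
  obtain ⟨eU⟩ := hU
  obtain ⟨eT⟩ := hT
  unfold numCommonCards
  rw [← deck_congr eU, ← deck_congr eT]
  unfold deck
  simp only [unlabelled_card_card]
  have key := card_inter_map_eq (γ := UnlabelledGraph.{u})
    (fun v : ↥({a}ᶜ : Set V) => pairCard G a v)
    (fun v : ↥({b}ᶜ : Set V) => pairCard G b v) (fun j => ⟨p j, hpa j⟩) (fun j => ⟨q j, hqb j⟩)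
    (fun i j h => hp (congrArg Subtype.val h)) (fun i j h => hq (congrArg Subtype.val h)) hm P
    (fun u t h => by
      obtain ⟨j, h⟩ := hc u t u.2 t.2 h
      exact ⟨j, by simpa [Subtype.ext_iff] using h⟩)
  convert key

/-! ### Isomorphism invariants of a graph with two deleted vertices -/

section Invariants

variable {V : Type u} [Fintype V] [DecidableEq V] (G : SimpleGraph V) [DecidableRel G.Adj]

/-- The degree of `v` after deleting `a` and `b`. -/
def pairDeg (a b v : V) : ℕ := (((G.neighborFinset v).erase a).erase b).card

variable {G}

theorem pairDeg_add {a b : V} (hab : a ≠ b) (v : V) :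
    pairDeg G a b v + (if G.Adj v a then 1 else 0) + (if G.Adj v b then 1 else 0) =
      G.degree v := by
  unfold pairDeg
  rw [← G.card_neighborFinset_eq_degree, Finset.card_erase_eq_ite, Finset.card_erase_eq_ite]
  simp only [Finset.mem_erase, SimpleGraph.mem_neighborFinset, ne_eq, hab.symm, not_false_eq_true,
    true_and]
  have h0 : G.Adj v a → G.Adj v b → 2 ≤ (G.neighborFinset v).card := fun h1 h2 => by
    have : ({a, b} : Finset V) ⊆ G.neighborFinset v := by
      intro z hz
      simp only [Finset.mem_insert, Finset.mem_singleton] at hz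
      rcases hz with rfl | rfl <;> simpa
    simpa [Finset.card_pair hab] using Finset.card_le_card this
  have h1 : ∀ z, G.Adj v z → 1 ≤ (G.neighborFinset v).card := fun z hz =>
    Finset.card_pos.2 ⟨z, by simpa⟩
  by_cases ha : G.Adj v a <;> by_cases hb : G.Adj v b
  · have := h0 ha hb
    simp [ha, hb] at this ⊢
    omega
  · have := h1 a ha
    simp [ha, hb] at this ⊢
    omega
  · have := h1 b hb
    simp [ha, hb] at this ⊢
    omega
  · simp [ha, hb]

/-- Isomorphic pair-deleted graphs, unpacked to a correspondence of vertices. -/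
theorem exists_of_pairCard_eq {a b a' b' : V} (h : pairCard G a b = pairCard G a' b') :
    ∃ φ : V → V, (∀ v, v ≠ a → v ≠ b → φ v ≠ a' ∧ φ v ≠ b' ∧
        pairDeg G a' b' (φ v) = pairDeg G a b v) ∧
      (∀ u v, u ≠ a → u ≠ b → v ≠ a → v ≠ b → (G.Adj (φ u) (φ v) ↔ G.Adj u v)) ∧
      (∀ u v, u ≠ a → u ≠ b → v ≠ a → v ≠ b → φ u = φ v → u = v) ∧
      (∀ t, t ≠ a' → t ≠ b' → ∃ v, v ≠ a ∧ v ≠ b ∧ φ v = t) := by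
  obtain ⟨e⟩ := unlabelled_eq_iff.1 h
  have mem : ∀ {v c d : V}, v ∈ ({c, d}ᶜ : Set V) ↔ v ≠ c ∧ v ≠ d := by simp
  -- The isomorphism is extended to all of V by an arbitrary value on the deleted vertices.
  let φ : V → V := fun v => if h : v ≠ a ∧ v ≠ b then (e ⟨v, mem.2 h⟩).1 else v
  have hφ : ∀ v (h : v ≠ a ∧ v ≠ b), φ v = (e ⟨v, mem.2 h⟩).1 := fun v h => dif_pos h
  have hadj : ∀ u v, u ≠ a → u ≠ b → v ≠ a → v ≠ b → (G.Adj (φ u) (φ v) ↔ G.Adj u v) := by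
    intro u v h1 h2 h3 h4
    rw [hφ u ⟨h1, h2⟩, hφ v ⟨h3, h4⟩]
    exact e.map_adj_iff (v := ⟨u, _⟩) (w := ⟨v, _⟩)
  have hinj : ∀ u v, u ≠ a → u ≠ b → v ≠ a → v ≠ b → φ u = φ v → u = v := by
    intro u v h1 h2 h3 h4 h5
    rw [hφ u ⟨h1, h2⟩, hφ v ⟨h3, h4⟩] at h5
    exact congrArg Subtype.val (e.injective (Subtype.ext h5))
  have hsurj : ∀ t, t ≠ a' → t ≠ b' → ∃ v, v ≠ a ∧ v ≠ b ∧ φ v = t := by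
    intro t h1 h2
    obtain ⟨h3, h4⟩ := mem.1 (e.symm ⟨t, mem.2 ⟨h1, h2⟩⟩).2
    refine ⟨_, h3, h4, ?_⟩
    rw [hφ _ ⟨h3, h4⟩]
    simp
  have hne : ∀ v, v ≠ a → v ≠ b → φ v ≠ a' ∧ φ v ≠ b' := by
    intro v h1 h2
    rw [hφ v ⟨h1, h2⟩]
    exact mem.1 (e _).2
  refine ⟨φ, fun v h1 h2 => ⟨(hne v h1 h2).1, (hne v h1 h2).2, ?_⟩, hadj, hinj, hsurj⟩
  unfold pairDeg
  symm
  refine Finset.card_bij (fun z _ => φ z) ?_ ?_ ?_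
  · intro z hz
    simp only [Finset.mem_erase, SimpleGraph.mem_neighborFinset] at hz ⊢
    exact ⟨(hne z hz.2.1 hz.1).2, (hne z hz.2.1 hz.1).1, (hadj v z h1 h2 hz.2.1 hz.1).2 hz.2.2⟩
  · intro z hz z' hz'
    simp only [Finset.mem_erase] at hz hz'
    exact hinj z z' hz.2.1 hz.1 hz'.2.1 hz'.1
  · intro t ht
    simp only [Finset.mem_erase, SimpleGraph.mem_neighborFinset] at ht
    obtain ⟨z, h3, h4, rfl⟩ := hsurj t ht.2.1 ht.1
    refine ⟨z, ?_, rfl⟩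
    simp only [Finset.mem_erase, SimpleGraph.mem_neighborFinset]
    exact ⟨h4, h3, (hadj v z h1 h2 h3 h4).1 ht.2.2⟩

theorem exists_pairDeg {a b a' b' : V} (h : pairCard G a b = pairCard G a' b') {v : V}
    (ha : v ≠ a) (hb : v ≠ b) :
    ∃ v', v' ≠ a' ∧ v' ≠ b' ∧ pairDeg G a' b' v' = pairDeg G a b v := by
  obtain ⟨φ, h1, -⟩ := exists_of_pairCard_eq h
  exact ⟨φ v, h1 v ha hb⟩

/-- Handshake count: deleting a and b destroys d(a) + d(b) edges, with the edge ab, if present,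
counted twice. Stated over ℤ to avoid truncated subtraction. -/
theorem sum_pairDeg {a b : V} (hab : a ≠ b) :
    ((∑ v ∈ (Finset.univ.erase a).erase b, pairDeg G a b v : ℕ) : ℤ) =
      ∑ v, (G.degree v : ℤ) - 2 * (G.degree a + G.degree b - if G.Adj a b then 1 else 0) := by
  have e1 : ∀ v, (pairDeg G a b v : ℤ) =
      G.degree v - (if G.Adj a v then 1 else 0) - (if G.Adj b v then 1 else 0) := by
    intro v
    rw [← pairDeg_add hab v]
    simp only [G.adj_comm a, G.adj_comm b]
    push_cast
    ring
  have e2 : ∀ z, ∑ v, (if G.Adj z v then (1 : ℤ) else 0) = G.degree z := by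
    intro z
    rw [Finset.sum_boole, ← G.card_neighborFinset_eq_degree]
    congr 2
    ext v
    simp
  have e3 : ∀ F : V → ℤ, ∑ v ∈ (Finset.univ.erase a).erase b, F v = ∑ v, F v - F a - F b := by
    intro F
    have h1 := Finset.add_sum_erase Finset.univ F (Finset.mem_univ a)
    have h2 := Finset.add_sum_erase (Finset.univ.erase a) F
      (Finset.mem_erase.2 ⟨hab.symm, Finset.mem_univ b⟩)
    linarith
  push_cast
  rw [e3]
  simp only [e1, Finset.sum_sub_distrib, e2, SimpleGraph.irrefl, if_false, G.adj_comm b a]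
  ring

theorem sum_pairDeg_eq {a b a' b' : V} (h : pairCard G a b = pairCard G a' b') :
    ∑ v ∈ (Finset.univ.erase a).erase b, pairDeg G a b v =
      ∑ v ∈ (Finset.univ.erase a').erase b', pairDeg G a' b' v := by
  obtain ⟨φ, h1, -, h3, h4⟩ := exists_of_pairCard_eq h
  refine Finset.sum_bij (fun v _ => φ v) ?_ ?_ ?_ ?_
  · intro v hv
    simp only [Finset.mem_erase, Finset.mem_univ, and_true] at hv ⊢
    exact ⟨(h1 v hv.2 hv.1).2.1, (h1 v hv.2 hv.1).1⟩
  · intro u hu v hv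
    simp only [Finset.mem_erase, Finset.mem_univ, and_true] at hu hv
    exact h3 u v hu.2 hu.1 hv.2 hv.1
  · intro t ht
    simp only [Finset.mem_erase, Finset.mem_univ, and_true] at ht
    obtain ⟨v, h5, h6, rfl⟩ := h4 t ht.2 ht.1
    exact ⟨v, by simp [h5, h6], rfl⟩
  · intro v hv
    simp only [Finset.mem_erase, Finset.mem_univ, and_true] at hv
    exact (h1 v hv.2 hv.1).2.2.symm

/-- Isomorphic pair-deleted graphs arise by deleting equally many edges. -/
theorem degree_add_degree_eq {a b a' b' : V} (hab : a ≠ b) (hab' : a' ≠ b')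
    (h : pairCard G a b = pairCard G a' b') :
    G.degree a + G.degree b + (if G.Adj a' b' then 1 else 0) =
      G.degree a' + G.degree b' + (if G.Adj a b then 1 else 0) := by
  have h1 := congrArg (fun z : ℕ => (z : ℤ)) (sum_pairDeg_eq h)
  rw [sum_pairDeg hab, sum_pairDeg hab'] at h1
  zify
  linarith

/-- The vertices of degree `d` that are deleted, or whose degree drops. -/
def lostVerts (G : SimpleGraph V) [DecidableRel G.Adj] (d : ℕ) (a b : V) : Finset V :=
  Finset.univ.filter fun v => G.degree v = d ∧ (v = a ∨ v = b ∨ G.Adj v a ∨ G.Adj v b)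

theorem mem_lostVerts {d : ℕ} {a b v : V} :
    v ∈ lostVerts G d a b ↔ G.degree v = d ∧ (v = a ∨ v = b ∨ G.Adj v a ∨ G.Adj v b) := by
  simp [lostVerts]

/-- Because d bounds all degrees, a surviving vertex has degree d after the deletion only if it had
degree d before and lost no neighbour; nothing can drop to d from above. -/
theorem card_lostVerts_add {d : ℕ} (hd : ∀ v, G.degree v ≤ d) {a b : V} (hab : a ≠ b) :
    (lostVerts G d a b).card +
        (((Finset.univ.erase a).erase b).filter fun v => pairDeg G a b v = d).card =
      (Finset.univ.filter fun v => G.degree v = d).card := by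
  rw [← Finset.card_union_of_disjoint]
  · congr 1
    ext v
    have h1 := pairDeg_add (G := G) hab v
    have h2 := hd v
    simp only [Finset.mem_union, mem_lostVerts, Finset.mem_filter, Finset.mem_erase,
      Finset.mem_univ, and_true, true_and]
    by_cases h3 : G.Adj v a <;> by_cases h4 : G.Adj v b <;> simp only [h3, h4, if_true, if_false]
      at h1 <;> simp only [h3, h4, or_true, or_false, and_true] <;> grind
  · rw [Finset.disjoint_left]
    intro v hv
    have h1 := pairDeg_add (G := G) hab v
    rw [mem_lostVerts] at hv
    simp only [Finset.mem_filter, Finset.mem_erase, Finset.mem_univ, and_true]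
    rintro ⟨⟨h2, h3⟩, h4⟩
    obtain ⟨h5, h6 | h6 | h6 | h6⟩ := hv
    · exact h3 h6
    · exact h2 h6
    · rw [if_pos h6] at h1
      omega
    · rw [if_pos h6] at h1
      omega

/-- Isomorphic pair-deleted graphs lose equally many vertices of the maximum degree. -/
theorem card_lostVerts_eq {d : ℕ} (hd : ∀ v, G.degree v ≤ d) {a b a' b' : V} (hab : a ≠ b)
    (hab' : a' ≠ b') (h : pairCard G a b = pairCard G a' b') :
    (lostVerts G d a b).card = (lostVerts G d a' b').card := by
  have h1 := card_lostVerts_add hd hab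
  have h2 := card_lostVerts_add hd hab'
  suffices (((Finset.univ.erase a).erase b).filter fun v => pairDeg G a b v = d).card =
      (((Finset.univ.erase a').erase b').filter fun v => pairDeg G a' b' v = d).card by omega
  obtain ⟨φ, h1, -, h3, h4⟩ := exists_of_pairCard_eq h
  refine Finset.card_bij (fun v _ => φ v) ?_ ?_ ?_
  · intro v hv
    simp only [Finset.mem_filter, Finset.mem_erase, Finset.mem_univ, and_true] at hv ⊢
    have := h1 v hv.1.2 hv.1.1
    exact ⟨⟨this.2.1, this.1⟩, this.2.2.trans hv.2⟩
  · intro u hu v hv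
    simp only [Finset.mem_filter, Finset.mem_erase, Finset.mem_univ, and_true] at hu hv
    exact h3 u v hu.1.2 hu.1.1 hv.1.2 hv.1.1
  · intro t ht
    simp only [Finset.mem_filter, Finset.mem_erase, Finset.mem_univ, and_true] at ht
    obtain ⟨v, h5, h6, rfl⟩ := h4 t ht.1.2 ht.1.1
    refine ⟨v, ?_, rfl⟩
    simp only [Finset.mem_filter, Finset.mem_erase, Finset.mem_univ, and_true]
    exact ⟨⟨h6, h5⟩, (h1 v h5 h6).2.2.symm.trans ht.2⟩

/-- The form in which the count of maximum-degree vertices separates cards. -/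
theorem pairCard_ne_of_lostVerts {d : ℕ} (hd : ∀ v, G.degree v ≤ d) {a b a' b' : V} (hab : a ≠ b)
    (hab' : a' ≠ b') {y z : V} (hyz : y ≠ z) (hy : y ∈ lostVerts G d a b)
    (hz : z ∈ lostVerts G d a b) {t : V} (ht : ∀ v ∈ lostVerts G d a' b', v = t) :
    pairCard G a b ≠ pairCard G a' b' := by
  intro h
  have h1 := card_lostVerts_eq hd hab hab' h
  have h2 : 1 < (lostVerts G d a b).card := Finset.one_lt_card.2 ⟨y, hy, z, hz, hyz⟩
  have h3 : (lostVerts G d a' b').card ≤ 1 :=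
    Finset.card_le_one.2 fun u hu v hv => (ht u hu).trans (ht v hv).symm
  omega

end Invariants

/-! ### Sunshine graphs as cycles with leaves attached -/

/-- `v` is a leaf attached to `s`. -/
def LeafAt {V : Type*} (G : SimpleGraph V) (v s : V) : Prop := ∀ u, G.Adj v u ↔ u = s

/-- `G` consists of the cycle `x 0, …, x (c - 1)` and leaves attached to it. -/
structure IsSun {V : Type*} (G : SimpleGraph V) (c : ℕ) (x : ℤ → V) : Prop where
  three_le : 3 ≤ c
  eq_iff : ∀ i j : ℤ, x i = x j ↔ i ≡ j [ZMOD c]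
  adj_iff : ∀ i j : ℤ, G.Adj (x i) (x j) ↔ (j ≡ i + 1 [ZMOD c] ∨ i ≡ j + 1 [ZMOD c])
  cycle_or_leaf : ∀ v, (∃ i, v = x i) ∨ ∃ i, LeafAt G v (x i)

theorem LeafAt.adj {V : Type*} {G : SimpleGraph V} {v s : V} (h : LeafAt G v s) : G.Adj v s :=
  (h s).2 rfl

theorem LeafAt.degree {V : Type*} [Fintype V] {G : SimpleGraph V} [DecidableRel G.Adj] {v s : V}
    (h : LeafAt G v s) : G.degree v = 1 := by
  rw [SimpleGraph.degree_eq_one_iff_existsUnique_adj]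
  exact ⟨s, h.adj, fun u hu => (h u).1 hu⟩

theorem exists_leafAt {V : Type*} [Fintype V] {G : SimpleGraph V} [DecidableRel G.Adj] {v : V}
    (h : G.degree v = 1) : ∃ s, LeafAt G v s := by
  obtain ⟨s, h1, h2⟩ := SimpleGraph.degree_eq_one_iff_existsUnique_adj.1 h
  exact ⟨s, fun u => ⟨h2 u, fun h => h ▸ h1⟩⟩

/-- In a connected graph, a leaf attached to a leaf leaves room for nothing else. -/
theorem eq_or_eq_of_leafAt_leafAt {V : Type*} {G : SimpleGraph V} (hG : G.Connected) {u v : V}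
    (hu : LeafAt G u v) (hv : LeafAt G v u) (z : V) : z = u ∨ z = v := by
  obtain ⟨p⟩ := hG.preconnected u z
  suffices ∀ a b, G.Walk a b → (a = u ∨ a = v) → (b = u ∨ b = v) from this u z p (Or.inl rfl)
  intro a b q
  induction q with
  | nil => exact id
  | cons h _ ih =>
    rintro (rfl | rfl)
    · exact ih (Or.inr ((hu _).1 h))
    · exact ih (Or.inl ((hv _).1 h))

/-- By connectivity every vertex off the skeleton is a leaf. Its neighbour lies on the cycle, since
two adjacent leaves would be the whole graph. -/
theorem IsLabelling.isSun {V : Type u} [Fintype V] {G : SimpleGraph V} [DecidableRel G.Adj]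
    {w : V} {c : ℕ} {x : ℤ → V} {ν : ℤ} (hx : IsLabelling G w c x ν) (hG : G.Connected) :
    IsSun G c x := by
  refine ⟨hx.three_le, hx.eq_iff, hx.adj_iff, fun v => ?_⟩
  by_cases hv : v ∈ Set.range x
  · obtain ⟨i, hi⟩ := hv
    exact Or.inl ⟨i, hi.symm⟩
  right
  have hleaf : ∀ z, z ∉ Set.range x → G.degree z = 1 := by
    intro z hz
    have hz0 : G.degree z ≠ 0 := by
      have : Nontrivial V := ⟨⟨z, x 0, fun h => hz ⟨0, h.symm⟩⟩⟩
      exact (hG.preconnected.degree_pos_of_nontrivial z).ne'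
    rw [hx.range_eq] at hz
    simp only [skelVerts, Set.mem_ofPred_eq, not_and, not_not] at hz
    exact hz hz0
  obtain ⟨s, hs⟩ := exists_leafAt (hleaf v hv)
  by_cases hsx : s ∈ Set.range x
  · obtain ⟨i, rfl⟩ := hsx
    exact ⟨i, hs⟩
  · obtain ⟨t, ht⟩ := exists_leafAt (hleaf s hsx)
    have htv : v = t := (ht v).1 hs.adj.symm
    subst htv
    rcases eq_or_eq_of_leafAt_leafAt hG hs ht (x 0) with h | h
    · exact absurd ⟨0, h⟩ hv
    · exact absurd ⟨0, h⟩ hsx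

namespace IsSun

variable {V : Type*} {G : SimpleGraph V} {c : ℕ} {x : ℤ → V}

theorem shift (hx : IsSun G c x) (s : ℤ) : IsSun G c fun i => x (i + s) where
  three_le := hx.three_le
  eq_iff i j := by
    rw [hx.eq_iff]
    exact ⟨fun h => h.add_right_cancel' s, fun h => h.add_right s⟩
  adj_iff i j := by
    rw [hx.adj_iff, add_right_comm i, add_right_comm j]
    exact or_congr ⟨fun h => h.add_right_cancel' s, fun h => h.add_right s⟩
      ⟨fun h => h.add_right_cancel' s, fun h => h.add_right s⟩
  cycle_or_leaf v := by
    rcases hx.cycle_or_leaf v with ⟨i, hi⟩ | ⟨i, hi⟩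
    · exact Or.inl ⟨i - s, by simpa using hi⟩
    · exact Or.inr ⟨i - s, by simpa using hi⟩

theorem neg (hx : IsSun G c x) : IsSun G c fun i => x (-i) where
  three_le := hx.three_le
  eq_iff i j := by
    rw [hx.eq_iff]
    exact ⟨fun h => by simpa using h.neg, fun h => h.neg⟩
  adj_iff i j := by
    rw [hx.adj_iff, or_comm]
    refine or_congr ⟨fun h => ?_, fun h => ?_⟩ ⟨fun h => ?_, fun h => ?_⟩
    · have := h.add_right (i + j)
      convert this using 1 <;> ring
    · have := h.add_right (-i - j)
      convert this using 1 <;> ring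
    · have := h.add_right (i + j)
      convert this using 1 <;> ring
    · have := h.add_right (-i - j)
      convert this using 1 <;> ring
  cycle_or_leaf v := by
    rcases hx.cycle_or_leaf v with ⟨i, hi⟩ | ⟨i, hi⟩
    · exact Or.inl ⟨-i, by simpa using hi⟩
    · exact Or.inr ⟨-i, by simpa using hi⟩

theorem adj_succ (hx : IsSun G c x) (i : ℤ) : G.Adj (x i) (x (i + 1)) :=
  (hx.adj_iff _ _).2 (Or.inl rfl)

theorem adj_pred (hx : IsSun G c x) (i : ℤ) : G.Adj (x i) (x (i - 1)) :=
  (hx.adj_iff _ _).2 (Or.inr (by simp))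

theorem eq_of_adj (hx : IsSun G c x) {i j : ℤ} (h : G.Adj (x i) (x j)) :
    x j = x (i + 1) ∨ x j = x (i - 1) := by
  rcases (hx.adj_iff i j).1 h with h | h
  · exact Or.inl ((hx.eq_iff _ _).2 h)
  · refine Or.inr ((hx.eq_iff _ _).2 ?_)
    have := h.sub_right 1
    simpa using this.symm

theorem succ_ne_pred (hx : IsSun G c x) (i : ℤ) : x (i + 1) ≠ x (i - 1) := by
  intro h
  have h1 := ((hx.eq_iff _ _).1 h).dvd
  have h2 := hx.three_le
  have h3 := Int.le_of_dvd (b := 2) (by norm_num) ((dvd_neg.2 h1).trans (by ring_nf; rfl))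
  omega

theorem not_leafAt (hx : IsSun G c x) (i : ℤ) (s : V) : ¬ LeafAt G (x i) s := fun h =>
  hx.succ_ne_pred i (((h _).1 (hx.adj_succ i)).trans ((h _).1 (hx.adj_pred i)).symm)

theorem leafAt_of_adj (hx : IsSun G c x) {v : V} {i : ℤ} (hv : ∀ j, v ≠ x j) (h : G.Adj v (x i)) :
    LeafAt G v (x i) := by
  rcases hx.cycle_or_leaf v with ⟨j, hj⟩ | ⟨j, hj⟩
  · exact absurd hj (hv j)
  · rwa [(hj _).1 h]

/-- An index in `[0, c)` and a flag for each vertex, determining adjacency. -/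
theorem exists_code (hx : IsSun G c x) : ∃ κ : V → ℤ × Bool, ∀ v, 0 ≤ (κ v).1 ∧ (κ v).1 < c ∧
    ((κ v).2 = true ∧ v = x (κ v).1 ∨ (κ v).2 = false ∧ LeafAt G v (x (κ v).1)) := by
  have hc : (0 : ℤ) < c := by
    have := hx.three_le
    omega
  have hmod : ∀ i, x (i % c) = x i := fun i => (hx.eq_iff _ _).2 (Int.mod_modEq i c)
  suffices ∀ v, ∃ k : ℤ × Bool, 0 ≤ k.1 ∧ k.1 < c ∧
      (k.2 = true ∧ v = x k.1 ∨ k.2 = false ∧ LeafAt G v (x k.1)) from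
    ⟨fun v => (this v).choose, fun v => (this v).choose_spec⟩
  intro v
  rcases hx.cycle_or_leaf v with ⟨i, hi⟩ | ⟨i, hi⟩
  · exact ⟨(i % c, true), Int.emod_nonneg _ hc.ne', Int.emod_lt_of_pos _ hc,
      Or.inl ⟨rfl, by rw [hmod]; exact hi⟩⟩
  · exact ⟨(i % c, false), Int.emod_nonneg _ hc.ne', Int.emod_lt_of_pos _ hc,
      Or.inr ⟨rfl, by rw [hmod]; exact hi⟩⟩

theorem eq_of_eq (hx : IsSun G c x) {i j : ℤ} (hi : 0 ≤ i) (hi' : i < c) (hj : 0 ≤ j) (hj' : j < c)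
    (h : x i = x j) : i = j := by
  have h1 : i % c = j % c := (hx.eq_iff _ _).1 h
  rwa [Int.emod_eq_of_lt hi hi', Int.emod_eq_of_lt hj hj'] at h1

theorem filter_code_true [Fintype V] (hx : IsSun G c x) {κ : V → ℤ × Bool}
    (hκ : ∀ v, 0 ≤ (κ v).1 ∧ (κ v).1 < c ∧
      ((κ v).2 = true ∧ v = x (κ v).1 ∨ (κ v).2 = false ∧ LeafAt G v (x (κ v).1)))
    {i : ℤ} (hi : 0 ≤ i) (hi' : i < c) :
    Finset.univ.filter (fun v => κ v = (i, true)) = {x i} := by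
  ext v
  obtain ⟨h1, h2, h3⟩ := hκ v
  rw [Finset.mem_filter, Finset.mem_singleton]
  constructor
  · rintro ⟨-, h⟩
    simp only [h] at h3
    simpa using h3
  · intro h
    refine ⟨Finset.mem_univ _, ?_⟩
    rcases h3 with ⟨h3, h4⟩ | ⟨-, h3⟩
    · exact Prod.ext (hx.eq_of_eq h1 h2 hi hi' (h4.symm.trans h)) h3
    · rw [h] at h3
      exact absurd h3 (hx.not_leafAt _ _)

section Fintype

variable [Fintype V] [DecidableEq V] [DecidableRel G.Adj]

variable (G x) in
/-- The leaves attached to `x i`. -/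
def leaves (i : ℤ) : Finset V :=
  ((G.neighborFinset (x i)).erase (x (i + 1))).erase (x (i - 1))

theorem card_leaves (hx : IsSun G c x) (i : ℤ) : (leaves G x i).card + 2 = G.degree (x i) := by
  unfold leaves
  have h1 : x (i + 1) ∈ G.neighborFinset (x i) := by simpa using hx.adj_succ i
  have h2 : x (i - 1) ∈ (G.neighborFinset (x i)).erase (x (i + 1)) :=
    Finset.mem_erase.2 ⟨(hx.succ_ne_pred i).symm, by simpa using hx.adj_pred i⟩
  have h3 := Finset.card_erase_add_one h1
  have h4 := Finset.card_erase_add_one h2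
  rw [← G.card_neighborFinset_eq_degree]
  omega

theorem mem_leaves (hx : IsSun G c x) {i : ℤ} {v : V} : v ∈ leaves G x i ↔ LeafAt G v (x i) := by
  simp only [leaves, Finset.mem_erase, SimpleGraph.mem_neighborFinset]
  constructor
  · rintro ⟨h1, h2, h3⟩
    refine hx.leafAt_of_adj (fun j hj => ?_) h3.symm
    subst hj
    rcases hx.eq_of_adj h3 with h | h
    · exact h2 h
    · exact h1 h
  · intro h
    exact ⟨fun h' => hx.not_leafAt _ _ (h' ▸ h), fun h' => hx.not_leafAt _ _ (h' ▸ h), h.adj.symm⟩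

theorem filter_code_false (hx : IsSun G c x) {κ : V → ℤ × Bool}
    (hκ : ∀ v, 0 ≤ (κ v).1 ∧ (κ v).1 < c ∧
      ((κ v).2 = true ∧ v = x (κ v).1 ∨ (κ v).2 = false ∧ LeafAt G v (x (κ v).1)))
    {i : ℤ} (hi : 0 ≤ i) (hi' : i < c) :
    Finset.univ.filter (fun v => κ v = (i, false)) = leaves G x i := by
  ext v
  obtain ⟨h1, h2, h3⟩ := hκ v
  rw [hx.mem_leaves, Finset.mem_filter]
  constructor
  · rintro ⟨-, h⟩
    simp only [h] at h3
    simpa using h3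
  · intro h
    refine ⟨Finset.mem_univ _, ?_⟩
    rcases h3 with ⟨-, h3⟩ | ⟨h3, h4⟩
    · rw [h3] at h
      exact absurd h (hx.not_leafAt _ _)
    · exact Prod.ext (hx.eq_of_eq h1 h2 hi hi' (((h4 _).1 h.adj)).symm) h3

/-- The order of a sunshine graph. -/
theorem card_eq_sum (hx : IsSun G c x) :
    Fintype.card V = ∑ i ∈ Finset.range c, (G.degree (x (i : ℤ)) - 1) := by
  -- The vertices with index i are `x i` and its d(x i) - 2 leaves.
  obtain ⟨κ, hκ⟩ := hx.exists_code
  rw [← Finset.card_univ, Finset.card_eq_sum_card_fiberwise (f := fun v => (κ v).1.toNat)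
    (t := Finset.range c)]
  · refine Finset.sum_congr rfl fun i hi => ?_
    have hi1 : ((i : ℕ) : ℤ) < c := by exact_mod_cast Finset.mem_range.1 hi
    have e : Finset.univ.filter (fun v => (κ v).1.toNat = i) =
        Finset.univ.filter (fun v => κ v = ((i : ℤ), true)) ∪
        Finset.univ.filter (fun v => κ v = ((i : ℤ), false)) := by
      ext v
      simp only [Finset.mem_filter, Finset.mem_union, Finset.mem_univ, true_and, Prod.ext_iff]
      have := (hκ v).1
      have h2 := Bool.eq_false_or_eq_true (κ v).2
      constructor
      · intro h
        have h3 : (κ v).1 = (i : ℤ) := by omega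
        tauto
      · intro h
        have h3 : (κ v).1 = (i : ℤ) := by tauto
        omega
    rw [e, Finset.card_union_of_disjoint, hx.filter_code_true hκ (by positivity) hi1,
      hx.filter_code_false hκ (by positivity) hi1, Finset.card_singleton]
    · have := hx.card_leaves i
      omega
    · rw [Finset.disjoint_left]
      intro v h1 h2
      simp only [Finset.mem_filter, Finset.mem_univ, true_and] at h1 h2
      rw [h1] at h2
      simp at h2
  · intro v _
    have h1 := hκ v
    simp only [Finset.coe_range, Set.mem_Iio]
    omega

/-- Two labellings with the same degrees are related by an automorphism. -/
theorem exists_aut {y : ℤ → V} (hx : IsSun G c x) (hy : IsSun G c y)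
    (hd : ∀ i, G.degree (y i) = G.degree (x i)) : ∃ φ : G ≃g G, ∀ i, φ (x i) = y i := by
  obtain ⟨κ, hκ⟩ := hx.exists_code
  obtain ⟨μ, hμ⟩ := hy.exists_code
  -- Equal degrees mean equal numbers of leaves at corresponding cycle vertices, so all fibres of
  -- the two codes have the same size and some bijection preserves codes.
  have hfib : ∀ z, Nonempty ({v // κ v = z} ≃ {v // μ v = z}) := by
    rintro ⟨i, b⟩
    by_cases hi : 0 ≤ i ∧ i < c
    · rw [← Fintype.card_eq, Fintype.card_subtype, Fintype.card_subtype]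
      cases b
      · rw [hx.filter_code_false hκ hi.1 hi.2, hy.filter_code_false hμ hi.1 hi.2]
        have h1 := hx.card_leaves i
        have h2 := hy.card_leaves i
        have h3 := hd i
        omega
      · rw [hx.filter_code_true hκ hi.1 hi.2, hy.filter_code_true hμ hi.1 hi.2]
        rfl
    · have h1 : IsEmpty {v // κ v = (i, b)} := ⟨fun v => hi (by
        have := hκ v.1
        rw [v.2] at this
        exact ⟨this.1, this.2.1⟩)⟩
      have h2 : IsEmpty {v // μ v = (i, b)} := ⟨fun v => hi (by
        have := hμ v.1
        rw [v.2] at this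
        exact ⟨this.1, this.2.1⟩)⟩
      exact ⟨Equiv.equivOfIsEmpty _ _⟩
  let e : V ≃ V := Equiv.ofFiberEquiv fun z => (hfib z).some
  have he : ∀ v, μ (e v) = κ v := fun v => Equiv.ofFiberEquiv_map _ v
  -- Adjacency can be read off the codes alone, so a code-preserving bijection is an automorphism.
  have key : ∀ {x : ℤ → V} {κ : V → ℤ × Bool}, IsSun G c x → (∀ v, 0 ≤ (κ v).1 ∧ (κ v).1 < c ∧
      ((κ v).2 = true ∧ v = x (κ v).1 ∨ (κ v).2 = false ∧ LeafAt G v (x (κ v).1))) →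
      ∀ u v, G.Adj u v ↔ ((κ u).2 = true ∧ (κ v).2 = true ∧ ((κ v).1 ≡ (κ u).1 + 1 [ZMOD c] ∨
        (κ u).1 ≡ (κ v).1 + 1 [ZMOD c]) ∨ (κ u).2 ≠ (κ v).2 ∧ (κ u).1 = (κ v).1) := by
    intro x κ hx hκ u v
    obtain ⟨u1, u2, u3⟩ := hκ u
    obtain ⟨v1, v2, v3⟩ := hκ v
    rcases u3 with ⟨u3, u4⟩ | ⟨u3, u4⟩ <;> rcases v3 with ⟨v3, v4⟩ | ⟨v3, v4⟩
    · simp only [u3, v3, true_and, ne_eq, not_true_eq_false, false_and, or_false]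
      conv_lhs => rw [u4, v4]
      exact hx.adj_iff _ _
    · simp only [u3, v3, Bool.false_eq_true, false_and, and_false, ne_eq, Bool.true_eq_false,
        not_false_eq_true, true_and, false_or]
      rw [G.adj_comm, v4]
      constructor
      · intro h
        exact hx.eq_of_eq u1 u2 v1 v2 (u4.symm.trans h)
      · intro h
        rw [← h]
        exact u4
    · simp only [u3, v3, Bool.false_eq_true, false_and, ne_eq,
        not_false_eq_true, true_and, false_or]
      rw [u4]
      constructor
      · intro h
        exact (hx.eq_of_eq v1 v2 u1 u2 (v4.symm.trans h)).symm
      · intro h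
        rw [h]
        exact v4
    · simp only [u3, v3, Bool.false_eq_true, false_and, ne_eq, not_true_eq_false, or_self, iff_false]
      rw [u4]
      intro h
      rw [h] at v4
      exact hx.not_leafAt _ _ v4
  refine ⟨⟨e, ?_⟩, fun i => ?_⟩
  · intro u v
    rw [key hy hμ, key hx hκ, he, he]
  · change e (x i) = y i
    obtain ⟨h1, h2, ⟨h3, h4⟩ | ⟨-, h4⟩⟩ := hκ (x i)
    · obtain ⟨-, -, ⟨-, h5⟩ | ⟨h5, -⟩⟩ := hμ (e (x i))
      · rw [h5, he, hy.eq_iff, ← hx.eq_iff]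
        exact h4.symm
      · rw [he, h3] at h5
        exact absurd h5 (by simp)
    · exact absurd h4 (hx.not_leafAt _ _)

end Fintype

end IsSun

/-! ### Sunshine graphs with a periodic degree sequence -/

theorem sum_range_periodic (p : ℕ) (g : ℕ → ℕ) (hg : ∀ i, g (i + p) = g i) (k r : ℕ) :
    ∑ i ∈ Finset.range (p * k + r), g i =
      k * ∑ i ∈ Finset.range p, g i + ∑ i ∈ Finset.range r, g i := by
  induction k with
  | zero => simp
  | succ k ih =>
    have h : p * (k + 1) + r = p + (p * k + r) := by ring
    rw [h, Finset.sum_range_add]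
    have h2 : ∀ i, g (p + i) = g i := fun i => by rw [add_comm, hg]
    simp only [h2, ih]
    ring

/-- The cycle `x` of `G` has `p * k` vertices, its degree sequence has period `p` and is
symmetric about `x 0`, which has the leaf `w`. -/
structure IsPeriodicSun {V : Type*} [Fintype V] (G : SimpleGraph V) [DecidableRel G.Adj]
    (p k : ℕ) (x : ℤ → V) (w : V) : Prop where
  sun : IsSun G (p * k) x
  leaf : LeafAt G w (x 0)
  degree_add : ∀ i s, (p : ℤ) ∣ s → G.degree (x (i + s)) = G.degree (x i)
  degree_neg : ∀ i, G.degree (x (-i)) = G.degree (x i)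

theorem LeafAt.unique {V : Type*} {G : SimpleGraph V} {v s t : V} (h : LeafAt G v s)
    (h' : LeafAt G v t) : s = t := (h' s).1 h.adj

theorem LeafAt.map {V : Type*} {G : SimpleGraph V} {v s : V} (h : LeafAt G v s) (φ : G ≃g G) :
    LeafAt G (φ v) (φ s) := by
  intro u
  obtain ⟨u, rfl⟩ := φ.surjective u
  rw [φ.map_adj_iff, h u, φ.injective.eq_iff]

namespace IsPeriodicSun

variable {V : Type u} [Fintype V] {G : SimpleGraph V} [DecidableRel G.Adj]
  {p k : ℕ} {x : ℤ → V} {w : V}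

theorem pos (hx : IsPeriodicSun G p k x w) : 0 < p ∧ 0 < k := by
  have h := hx.sun.three_le
  constructor <;> refine Nat.pos_of_ne_zero fun h0 => ?_ <;> simp [h0] at h

theorem dvd_of_eq (hx : IsPeriodicSun G p k x w) {i j : ℤ} (h : x i = x j) : (p : ℤ) ∣ j - i := by
  have := ((hx.sun.eq_iff i j).1 h).dvd
  push_cast at this
  exact (dvd_mul_right _ _).trans this

theorem ne_of_leafAt (hx : IsPeriodicSun G p k x w) {l s : V} (h : LeafAt G l s) (i : ℤ) :
    x i ≠ l := fun h' => hx.sun.not_leafAt i s (h' ▸ h)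

theorem degree_le (hx : IsPeriodicSun G p k x w) {d : ℕ} (h1 : 1 ≤ d)
    (h : ∀ i, G.degree (x i) ≤ d) (v : V) : G.degree v ≤ d := by
  rcases hx.sun.cycle_or_leaf v with ⟨m, rfl⟩ | ⟨m, hm⟩
  · exact h m
  · rwa [hm.degree]

variable [DecidableEq V]

theorem two_le_degree (hx : IsPeriodicSun G p k x w) (i : ℤ) : 2 ≤ G.degree (x i) := by
  have := hx.sun.card_leaves i
  omega

theorem three_le_degree (hx : IsPeriodicSun G p k x w) {i : ℤ} {v : V} (h : LeafAt G v (x i)) :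
    3 ≤ G.degree (x i) := by
  have h1 := hx.sun.card_leaves i
  have h2 := Finset.card_pos.2 ⟨v, hx.sun.mem_leaves.2 h⟩
  omega

theorem adj_iff_of_degree_eq_two (hx : IsPeriodicSun G p k x w) {i : ℤ} (h : G.degree (x i) = 2)
    (v : V) : G.Adj (x i) v ↔ v = x (i + 1) ∨ v = x (i - 1) := by
  constructor
  · intro h'
    by_cases hv : ∃ j, v = x j
    · obtain ⟨j, rfl⟩ := hv
      exact hx.sun.eq_of_adj h'
    · have := hx.three_le_degree
        (hx.sun.leafAt_of_adj (fun j hj => hv ⟨j, hj⟩) h'.symm)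
      omega
  · rintro (rfl | rfl)
    · exact hx.sun.adj_succ i
    · exact hx.sun.adj_pred i

theorem exists_leaf_ne (hx : IsPeriodicSun G p k x w) {i : ℤ} (h : G.degree (x i) = 4) (v : V) :
    ∃ l, LeafAt G l (x i) ∧ l ≠ v := by
  have h1 := hx.sun.card_leaves i
  obtain ⟨l, h2, h3⟩ := Finset.exists_mem_ne (s := IsSun.leaves G x i) (by omega) v
  exact ⟨l, hx.sun.mem_leaves.1 h2, h3⟩

theorem exists_leaf (hx : IsPeriodicSun G p k x w) {i : ℤ} (h : 3 ≤ G.degree (x i)) :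
    ∃ l, LeafAt G l (x i) := by
  have h1 := hx.sun.card_leaves i
  obtain ⟨l, h2⟩ := Finset.card_pos.1 (show 0 < (IsSun.leaves G x i).card by omega)
  exact ⟨l, hx.sun.mem_leaves.1 h2⟩

theorem leaf_unique (hx : IsPeriodicSun G p k x w) {i : ℤ} (h : G.degree (x i) = 3) {l l' : V}
    (hl : LeafAt G l (x i)) (hl' : LeafAt G l' (x i)) : l = l' := by
  have h1 := hx.sun.card_leaves i
  exact Finset.card_le_one.1 (show (IsSun.leaves G x i).card ≤ 1 by omega) _
    (hx.sun.mem_leaves.2 hl) _ (hx.sun.mem_leaves.2 hl')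

/-! #### Isomorphic pair-deleted graphs -/

theorem pairCard_rotate (hx : IsPeriodicSun G p k x w) {s : ℤ} (hs : (p : ℤ) ∣ s) (i j : ℤ) :
    pairCard G (x i) (x j) = pairCard G (x (i + s)) (x (j + s)) := by
  obtain ⟨φ, hφ⟩ := hx.sun.exists_aut (hx.sun.shift s) fun i => hx.degree_add i s hs
  rw [pairCard_aut φ, hφ, hφ]

omit [DecidableEq V] in
theorem pairCard_leaf (hx : IsPeriodicSun G p k x w) {l l' s : V} (h : LeafAt G l s)
    (h' : LeafAt G l' s) (i : ℤ) : pairCard G l (x i) = pairCard G l' (x i) :=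
  pairCard_twin (hx.ne_of_leafAt h i).symm (hx.ne_of_leafAt h' i).symm
    fun v _ => by rw [h v, h' v]

/-- The rotation may carry w to a leaf at `x m` other than l; leaves at the same vertex are twins,
so the choice does not matter. -/
theorem pairCard_leaf_rotate (hx : IsPeriodicSun G p k x w) {m : ℤ} (hm : (p : ℤ) ∣ m) {l : V}
    (hl : LeafAt G l (x m)) (i : ℤ) : pairCard G w (x i) = pairCard G l (x (i + m)) := by
  obtain ⟨φ, hφ⟩ := hx.sun.exists_aut (hx.sun.shift m) fun i => hx.degree_add i m hm
  have h := hx.leaf.map φ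
  rw [hφ, zero_add] at h
  rw [pairCard_aut φ, hφ, hx.pairCard_leaf h hl]

/-- Reflection about `x 0`, again up to exchanging the leaves at `x 0`. -/
theorem pairCard_neg (hx : IsPeriodicSun G p k x w) (i : ℤ) :
    pairCard G w (x i) = pairCard G w (x (-i)) := by
  obtain ⟨φ, hφ⟩ := hx.sun.exists_aut hx.sun.neg hx.degree_neg
  have h := hx.leaf.map φ
  rw [hφ, neg_zero] at h
  rw [pairCard_aut φ, hφ, hx.pairCard_leaf h hx.leaf]

/-- With i = ν, this and its reflected form `pairCard_sub'` supply the main family of common cards.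
-/
theorem pairCard_sub (hx : IsPeriodicSun G p k x w) {m : ℤ} (hm : (p : ℤ) ∣ m) {l : V}
    (hl : LeafAt G l (x m)) (i : ℤ) : pairCard G w (x (i - m)) = pairCard G (x i) l := by
  rw [hx.pairCard_leaf_rotate hm hl, sub_add_cancel, pairCard_comm]

theorem pairCard_sub' (hx : IsPeriodicSun G p k x w) {m : ℤ} (hm : (p : ℤ) ∣ m) {l : V}
    (hl : LeafAt G l (x m)) (i : ℤ) : pairCard G w (x (m - i)) = pairCard G (x i) l := by
  rw [hx.pairCard_neg, neg_sub, hx.pairCard_sub hm hl]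

/-- When `x 1` has degree two, it becomes a twin of `w` once `x 2` is deleted. -/
theorem pairCard_two (hx : IsPeriodicSun G p k x w) (h : G.degree (x 1) = 2) :
    pairCard G w (x 2) = pairCard G (x 1) (x 2) := by
  refine pairCard_twin (hx.ne_of_leafAt hx.leaf 2).symm (hx.sun.adj_succ 1).ne fun v hv => ?_
  rw [hx.leaf v, hx.adj_iff_of_degree_eq_two h]
  norm_num [hv]

theorem pairCard_neg_two (hx : IsPeriodicSun G p k x w) (h : G.degree (x 1) = 2) :
    pairCard G w (x (-2)) = pairCard G (x (-1)) (x (-2)) := by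
  refine pairCard_twin (hx.ne_of_leafAt hx.leaf _).symm
    (by simpa using (hx.sun.adj_pred (-1)).ne) fun v hv => ?_
  rw [hx.leaf v, hx.adj_iff_of_degree_eq_two (by rw [hx.degree_neg, h])]
  norm_num [hv]

/-! #### Indexing residue classes of cycle vertices -/

omit [DecidableEq V] in
theorem injective_sub (hx : IsPeriodicSun G p k x w) (a : ℤ) :
    Function.Injective fun j : Fin k => x (a - p * j) := by
  intro i j h
  have h1 := ((hx.sun.eq_iff _ _).1 h).dvd
  have h2 : ((p : ℤ) * k) ∣ p * (i - j) := by
    convert h1 using 1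
    · push_cast
      rfl
    · ring
  have h3 := (mul_dvd_mul_iff_left (by exact_mod_cast hx.pos.1.ne')).1 h2
  have h4 := Int.eq_zero_of_abs_lt_dvd h3 (by rw [abs_lt]; omega)
  omega

omit [DecidableEq V] in
theorem injective_sub' (hx : IsPeriodicSun G p k x w) (a : ℤ) :
    Function.Injective fun j : Fin k => x (p * j - a) := by
  intro i j h
  have h1 := ((hx.sun.eq_iff _ _).1 h).neg
  refine hx.injective_sub a ((hx.sun.eq_iff _ _).2 ?_)
  simpa using h1

omit [DecidableEq V] in
theorem exists_sub_eq (hx : IsPeriodicSun G p k x w) {a i : ℤ} (h : (p : ℤ) ∣ a - i) :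
    ∃ j : Fin k, x (a - p * j) = x i := by
  obtain ⟨s, hs⟩ := h
  have hk : (0 : ℤ) < k := by exact_mod_cast hx.pos.2
  have h1 := Int.emod_nonneg s hk.ne'
  have h2 := Int.emod_lt_of_pos s hk
  refine ⟨⟨(s % k).toNat, by omega⟩, (hx.sun.eq_iff _ _).2 (Int.modEq_iff_dvd.2 ?_)⟩
  simp only [Int.toNat_of_nonneg h1]
  refine ⟨-(s / k), ?_⟩
  have h3 := Int.emod_add_mul_ediv s k
  push_cast
  linear_combination (p : ℤ) * h3 - hs

omit [DecidableEq V] in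
theorem exists_sub_eq' (hx : IsPeriodicSun G p k x w) {a i : ℤ} (h : (p : ℤ) ∣ a + i) :
    ∃ j : Fin k, x (p * j - a) = x i := by
  obtain ⟨j, hj⟩ := hx.exists_sub_eq (a := a) (i := -i) (by simpa using h)
  refine ⟨j, (hx.sun.eq_iff _ _).2 ?_⟩
  simpa using ((hx.sun.eq_iff _ _).1 hj).neg

/-! #### Necessary conditions for isomorphism -/

variable {ν : ℤ}

/-- Edge balance. Here d is the number of edges lost with u once w is gone: d(u), less one if u = `x
0`. On the other side `x ν` takes two edges and t takes d(t), less one if adjacent to `x ν`, so d =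
d(t) + 1 or d = d(t). No leaf u loses enough edges. -/
theorem cases_of_pairCard_eq (hx : IsPeriodicSun G p k x w) (hν : G.degree (x ν) = 2) {u t : V}
    (hu : u ≠ w) (ht : t ≠ x ν) (h : pairCard G w u = pairCard G (x ν) t) :
    ∃ i, u = x i ∧ ∃ d, (i = 0 ∧ d + 1 = G.degree (x 0) ∨ x i ≠ x 0 ∧ d = G.degree (x i)) ∧
      ((∃ m, LeafAt G t (x m) ∧ 3 ≤ G.degree (x m) ∧ d = 2) ∨
        (t = x (ν + 1) ∧ d = G.degree (x (ν + 1))) ∨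
        (t = x (ν - 1) ∧ d = G.degree (x (ν - 1))) ∨
        ∃ j, t = x j ∧ x j ≠ x (ν + 1) ∧ x j ≠ x (ν - 1) ∧ d = G.degree (x j) + 1) := by
  have h1 := degree_add_degree_eq hu.symm ht.symm h
  rw [hx.leaf.degree, hν] at h1
  simp only [hx.leaf u, hx.adj_iff_of_degree_eq_two hν] at h1
  have htt : (∃ m, LeafAt G t (x m) ∧ 3 ≤ G.degree (x m)) ∨ ∃ j, t = x j := by
    rcases hx.sun.cycle_or_leaf t with h2 | ⟨m, h2⟩
    · exact Or.inr h2
    · exact Or.inl ⟨m, h2, hx.three_le_degree h2⟩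
  rcases hx.sun.cycle_or_leaf u with ⟨i, rfl⟩ | ⟨i, hi⟩
  · have hd : ∃ i', x i = x i' ∧
        ∃ d, (i' = 0 ∧ d + 1 = G.degree (x 0) ∨ x i' ≠ x 0 ∧ d = G.degree (x i')) ∧
          G.degree (x i) = d + if x i = x 0 then 1 else 0 := by
      by_cases h0 : x i = x 0
      · have := hx.two_le_degree 0
        exact ⟨0, h0, G.degree (x 0) - 1, Or.inl ⟨rfl, by omega⟩, by rw [h0, if_pos rfl]; omega⟩
      · exact ⟨i, rfl, G.degree (x i), Or.inr ⟨h0, rfl⟩, by rw [if_neg h0]; rfl⟩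
    obtain ⟨i', h2, d, h3, h4⟩ := hd
    refine ⟨i', h2, d, h3, ?_⟩
    rw [h4] at h1
    rcases htt with ⟨m, hm, hm'⟩ | ⟨j, rfl⟩
    · have h5 : ¬ (t = x (ν + 1) ∨ t = x (ν - 1)) := by
        rintro (h5 | h5) <;> exact hx.ne_of_leafAt hm _ h5.symm
      rw [if_neg h5, hm.degree] at h1
      exact Or.inl ⟨m, hm, hm', by omega⟩
    · by_cases h5 : x j = x (ν + 1)
      · rw [h5] at h1
        simp only [true_or, if_true] at h1
        exact Or.inr (Or.inl ⟨h5, by omega⟩)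
      · by_cases h6 : x j = x (ν - 1)
        · rw [h6] at h1
          simp only [or_true, if_true] at h1
          exact Or.inr (Or.inr (Or.inl ⟨h6, by omega⟩))
        · simp only [h5, h6, or_self, if_false] at h1
          exact Or.inr (Or.inr (Or.inr ⟨j, rfl, h5, h6, by omega⟩))
  · have h0 : u ≠ x 0 := (hx.ne_of_leafAt hi 0).symm
    rw [if_neg h0, hi.degree] at h1
    exfalso
    rcases htt with ⟨m, hm, hm'⟩ | ⟨j, rfl⟩
    · have h5 : ¬ (t = x (ν + 1) ∨ t = x (ν - 1)) := by
        rintro (h5 | h5) <;> exact hx.ne_of_leafAt hm _ h5.symm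
      rw [if_neg h5, hm.degree] at h1
      omega
    · have := hx.two_le_degree j
      split_ifs at h1 <;> omega

/-- Deleting a cycle vertex with leaves leaves an isolated vertex behind, which constrains the
pair deleted on the other side. -/
theorem eq_of_pairCard_eq_of_leaf (hx : IsPeriodicSun G p k x w) (hν : G.degree (x ν) = 2)
    {i j : ℤ} (hj : G.degree (x j) = 2) (hjν : x j ≠ x ν) {l : V} (hl : LeafAt G l (x i))
    (hlw : l ≠ w) (h : pairCard G w (x i) = pairCard G (x ν) (x j)) :
    G.degree (x (ν + 1)) = 2 ∧ x j = x (ν + 2) ∨ G.degree (x (ν - 1)) = 2 ∧ x j = x (ν - 2) := by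
  -- The leaf l is isolated once `x i` is deleted; v is its image.
  obtain ⟨v, hv1, hv2, hv3⟩ := exists_pairDeg h hlw (hx.ne_of_leafAt hl i).symm
  have hl0 : pairDeg G w (x i) l = 0 := by
    have := pairDeg_add (hx.ne_of_leafAt hx.leaf i).symm l (G := G)
    rw [if_pos hl.adj, hl.degree] at this
    omega
  have h1 := pairDeg_add hjν.symm v (G := G)
  rw [hv3, hl0] at h1
  -- If v is on the cycle, it has degree two and sits between `x ν` and `x j`. If v is a leaf, it
  -- hangs at one of these, impossible as both have degree two.
  rcases hx.sun.cycle_or_leaf v with ⟨m, rfl⟩ | ⟨m, hm⟩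
  · have h2 := hx.two_le_degree m
    by_cases h3 : G.Adj (x m) (x ν) <;> by_cases h4 : G.Adj (x m) (x j) <;>
      simp only [h3, h4, if_true, if_false] at h1 <;> try omega
    have h5 : G.degree (x m) = 2 := by omega
    rcases hx.sun.eq_of_adj h3.symm with h6 | h6 <;> rw [h6] at h4 h5
    · rcases hx.sun.eq_of_adj h4 with h7 | h7
      · exact Or.inl ⟨h5, by rw [h7]; ring_nf⟩
      · exact absurd (by rw [h7]; ring_nf) hjν
    · rcases hx.sun.eq_of_adj h4 with h7 | h7
      · exact absurd (by rw [h7]; ring_nf) hjν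
      · exact Or.inr ⟨h5, by rw [h7]; ring_nf⟩
  · have h2 := hx.three_le_degree hm
    rw [hm.degree] at h1
    simp only [hm _] at h1
    by_cases h3 : x ν = x m
    · rw [← h3] at h2
      omega
    · by_cases h4 : x j = x m
      · rw [← h4] at h2
        omega
      · simp [h3, h4] at h1

theorem exists_of_mem_lostVerts (hx : IsPeriodicSun G p k x w) {d : ℕ} (hd : 2 ≤ d) {i j : ℤ}
    {v : V} (hv : v ∈ lostVerts G d (x i) (x j)) : ∃ m, v = x m ∧ G.degree (x m) = d ∧
      (m = i ∨ m = i + 1 ∨ m = i - 1 ∨ m = j ∨ m = j + 1 ∨ m = j - 1) := by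
  obtain ⟨h1, h2⟩ := mem_lostVerts.1 hv
  rcases hx.sun.cycle_or_leaf v with ⟨m, rfl⟩ | ⟨m, hm⟩
  · have : ∃ m', x m = x m' ∧
        (m' = i ∨ m' = i + 1 ∨ m' = i - 1 ∨ m' = j ∨ m' = j + 1 ∨ m' = j - 1) := by
      rcases h2 with h2 | h2 | h2 | h2
      · exact ⟨i, h2, by simp⟩
      · exact ⟨j, h2, by simp⟩
      · rcases hx.sun.eq_of_adj h2.symm with h3 | h3
        · exact ⟨_, h3, by simp⟩
        · exact ⟨_, h3, by simp⟩
      · rcases hx.sun.eq_of_adj h2.symm with h3 | h3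
        · exact ⟨_, h3, by simp⟩
        · exact ⟨_, h3, by simp⟩
    obtain ⟨m', h3, h4⟩ := this
    exact ⟨m', h3, by rw [← h3, h1], h4⟩
  · rw [hm.degree] at h1
    omega

theorem exists_of_mem_lostVerts_leaf (hx : IsPeriodicSun G p k x w) {d : ℕ} (hd : 2 ≤ d) {i j : ℤ}
    {v l : V} (hl : LeafAt G l (x j)) (hv : v ∈ lostVerts G d (x i) l) :
    ∃ m, v = x m ∧ G.degree (x m) = d ∧ (m = i ∨ m = i + 1 ∨ m = i - 1 ∨ m = j) := by
  obtain ⟨h1, h2⟩ := mem_lostVerts.1 hv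
  rcases hx.sun.cycle_or_leaf v with ⟨m, rfl⟩ | ⟨m, hm⟩
  · have : ∃ m', x m = x m' ∧ (m' = i ∨ m' = i + 1 ∨ m' = i - 1 ∨ m' = j) := by
      rcases h2 with h2 | h2 | h2 | h2
      · exact ⟨i, h2, by simp⟩
      · exact absurd h2 (hx.ne_of_leafAt hl m)
      · rcases hx.sun.eq_of_adj h2.symm with h3 | h3
        · exact ⟨_, h3, by simp⟩
        · exact ⟨_, h3, by simp⟩
      · exact ⟨j, (hl _).1 h2.symm, by simp⟩
    obtain ⟨m', h3, h4⟩ := this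
    exact ⟨m', h3, by rw [← h3, h1], h4⟩
  · rw [hm.degree] at h1
    omega

theorem mem_lostVerts_zero (hx : IsPeriodicSun G p k x w) {d : ℕ} (h : G.degree (x 0) = d) (u : V) :
    x 0 ∈ lostVerts G d w u :=
  mem_lostVerts.2 ⟨h, Or.inr (Or.inr (Or.inl hx.leaf.adj.symm))⟩

end IsPeriodicSun

namespace IsPeriodicSun

variable {V : Type u} [Fintype V] [DecidableEq V] {G : SimpleGraph V} [DecidableRel G.Adj]
  {p k : ℕ} {x : ℤ → V} {w : V} {ν : ℤ}
  {VU VT : Type u} [Fintype VU] [Fintype VT] {U : SimpleGraph VU} {T : SimpleGraph VT}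

/-! #### Matchings of cards -/

theorem exists_leaf_family (hx : IsPeriodicSun G p k x w) :
    ∃ l : Fin k → V, (∀ j, LeafAt G (l j) (x (p * j))) ∧ Function.Injective l := by
  have h : ∀ j : Fin k, ∃ l, LeafAt G l (x (p * j)) := fun j => by
    refine hx.exists_leaf ?_
    have h1 := hx.degree_add 0 (p * j) (dvd_mul_right _ _)
    rw [zero_add] at h1
    rw [h1]
    exact hx.three_le_degree hx.leaf
  choose l hl using h
  refine ⟨l, hl, fun i j hij => ?_⟩
  have h1 := hl i
  rw [hij] at h1
  exact hx.injective_sub' 0 (by simpa using h1.unique (hl j))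

theorem exists_two_leaf_family (hx : IsPeriodicSun G p k x w) (h0 : G.degree (x 0) = 4) :
    ∃ l : Fin k × Bool → V, (∀ j, LeafAt G (l j) (x (p * j.1))) ∧ Function.Injective l := by
  obtain ⟨l, hl, hli⟩ := hx.exists_leaf_family
  have h : ∀ j : Fin k, ∃ l', LeafAt G l' (x (p * j)) ∧ l' ≠ l j := fun j => by
    refine hx.exists_leaf_ne ?_ _
    have h1 := hx.degree_add 0 (p * j) (dvd_mul_right _ _)
    rw [zero_add] at h1
    rw [h1, h0]
  choose l' hl' hne using h
  have hF : ∀ j : Fin k × Bool, LeafAt G (if j.2 then l j.1 else l' j.1) (x (p * j.1)) := by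
    rintro ⟨j, b⟩
    cases b
    · exact hl' j
    · exact hl j
  refine ⟨fun j => if j.2 then l j.1 else l' j.1, hF, ?_⟩
  intro i j hij
  have h1 := hF i
  simp only at hij
  rw [hij] at h1
  have h2 : i.1 = j.1 := hx.injective_sub' 0 (by simpa using h1.unique (hF j))
  obtain ⟨i, b⟩ := i
  obtain ⟨j, b'⟩ := j
  simp only at h2
  subst h2
  have h3 := hne i
  have h4 := h3.symm
  cases b <;> cases b' <;> simp_all

/-- The cycle vertices whose deletion from `G - w` matches the deletion of a leaf from
`G - x ν`, for two leaves at each `x (p * j)`. -/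
def twoSided (p : ℕ) (x : ℤ → V) (ν : ℤ) {k : ℕ} (j : Fin k × Bool) : V :=
  if j.2 then x (ν - p * j.1) else x (p * j.1 - ν)

/-- The hypothesis on 2ν says that the rotated positions (≡ ν) and the reflected ones (≡ -ν) lie in
different classes modulo p. -/
theorem twoSided_injective (hx : IsPeriodicSun G p k x w) (hν : ¬ (p : ℤ) ∣ 2 * ν) :
    Function.Injective (twoSided p x ν : Fin k × Bool → V) := by
  have h0 : ∀ i j : Fin k, x (ν - p * i) ≠ x (p * j - ν) := by
    intro i j h
    obtain ⟨z, hz⟩ := hx.dvd_of_eq h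
    exact hν ⟨i + j - z, by linear_combination -hz⟩
  rintro ⟨i, b⟩ ⟨j, b'⟩ h
  cases b <;> cases b' <;> simp only [twoSided, if_true, Bool.false_eq_true, if_false] at h
  · rw [hx.injective_sub' ν h]
  · exact absurd h.symm (h0 _ _)
  · exact absurd h (h0 _ _)
  · rw [hx.injective_sub ν h]

theorem exists_twoSided_eq (hx : IsPeriodicSun G p k x w) {i : ℤ}
    (h : (p : ℤ) ∣ ν - i ∨ (p : ℤ) ∣ ν + i) : ∃ j : Fin k × Bool, twoSided p x ν j = x i := by
  rcases h with h | h
  · obtain ⟨j, hj⟩ := hx.exists_sub_eq h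
    exact ⟨(j, true), by simpa [twoSided] using hj⟩
  · obtain ⟨j, hj⟩ := hx.exists_sub_eq' h
    exact ⟨(j, false), by simpa [twoSided] using hj⟩

omit [DecidableEq V] in
theorem twoSided_ne (hx : IsPeriodicSun G p k x w) (j : Fin k × Bool) : twoSided p x ν j ≠ w := by
  unfold twoSided
  split_ifs <;> exact hx.ne_of_leafAt hx.leaf _

theorem pairCard_twoSided (hx : IsPeriodicSun G p k x w) {l : Fin k × Bool → V}
    (hl : ∀ j, LeafAt G (l j) (x (p * j.1))) (j : Fin k × Bool) :
    pairCard G w (twoSided p x ν j) = pairCard G (x ν) (l j) := by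
  unfold twoSided
  split_ifs
  · exact hx.pairCard_sub (dvd_mul_right _ _) (hl j) ν
  · exact hx.pairCard_sub' (dvd_mul_right _ _) (hl j) ν

/-- The number of common cards when only the rotations of `x ν` onto itself contribute. -/
theorem numCommonCards_eq_of_rotations (hx : IsPeriodicSun G p k x w)
    (hU : Nonempty (card G w ≃g U)) (hT : Nonempty (card G (x ν) ≃g T))
    (hc : ∀ u t, u ≠ w → t ≠ x ν → pairCard G w u = pairCard G (x ν) t →
      ∃ i, u = x i ∧ (p : ℤ) ∣ ν - i) :
    numCommonCards U T = k := by
  obtain ⟨l, hl, hli⟩ := hx.exists_leaf_family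
  -- The cover takes the endpoint on the U side of every pair.
  rw [numCommonCards_eq hU hT (fun j : Fin k => x (ν - p * j)) l
    (fun j => hx.ne_of_leafAt hx.leaf _) (fun j => (hx.ne_of_leafAt (hl j) _).symm)
    (hx.injective_sub ν) hli (fun j => hx.pairCard_sub (dvd_mul_right _ _) (hl j) ν)
    (fun _ => True), Fintype.card_fin]
  intro u t hu ht h
  obtain ⟨i, rfl, hi⟩ := hc u t hu ht h
  obtain ⟨j, hj⟩ := hx.exists_sub_eq hi
  exact ⟨j, Or.inl ⟨hj, trivial⟩⟩

/-- The number of common cards when only the rotations and reflections of `x ν` onto itself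
contribute, and there are two leaves at each `x (p * j)`. -/
theorem numCommonCards_eq_of_dihedral (hx : IsPeriodicSun G p k x w) (h0 : G.degree (x 0) = 4)
    (hν : ¬ (p : ℤ) ∣ 2 * ν)
    (hU : Nonempty (card G w ≃g U)) (hT : Nonempty (card G (x ν) ≃g T))
    (hc : ∀ u t, u ≠ w → t ≠ x ν → pairCard G w u = pairCard G (x ν) t →
      ∃ i, u = x i ∧ ((p : ℤ) ∣ ν - i ∨ (p : ℤ) ∣ ν + i)) :
    numCommonCards U T = k * 2 := by
  obtain ⟨l, hl, hli⟩ := hx.exists_two_leaf_family h0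
  rw [numCommonCards_eq hU hT (twoSided p x ν) l hx.twoSided_ne
    (fun j => (hx.ne_of_leafAt (hl j) _).symm) (hx.twoSided_injective hν) hli
    (hx.pairCard_twoSided hl) (fun _ => True)]
  · simp
  intro u t hu ht h
  obtain ⟨i, rfl, hi⟩ := hc u t hu ht h
  obtain ⟨j, hj⟩ := hx.exists_twoSided_eq hi
  exact ⟨j, Or.inl ⟨hj, trivial⟩⟩

/-! #### The six degree sequences -/

theorem numCommonCards_S1b (hx : IsPeriodicSun G 3 k x w)
    (hd : ∀ i, i % 3 = 0 ∧ G.degree (x i) = 4 ∨ i % 3 ≠ 0 ∧ G.degree (x i) = 2)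
    (hν : ν % 3 = 1) (hU : Nonempty (card G w ≃g U)) (hT : Nonempty (card G (x ν) ≃g T)) :
    numCommonCards U T = k * 2 := by
  refine hx.numCommonCards_eq_of_dihedral (by have := hd 0; omega) (by omega) hU hT ?_
  intro u t hu ht h
  have hν2 : G.degree (x ν) = 2 := by have := hd ν; omega
  obtain ⟨i, rfl, d, hi, hcase⟩ := hx.cases_of_pairCard_eq hν2 hu ht h
  refine ⟨i, rfl, ?_⟩
  by_contra hi3
  have hdi := hd i
  have hd0 := hd 0
  have hd1 := hd (ν + 1)
  have hd2 := hd (ν - 1)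
  -- The failing congruences force 3 ∣ i, so d is 3 (i = 0) or 4. Only t = `x (ν - 1)` with d = 4,
  -- refuted by degree-four vertices, and a degree-two t with d = 3, refuted by the second leaf at
  -- `x 0`, survive the edge count.
  rcases hcase with ⟨m, hm, hm', hdm⟩ | ⟨rfl, hdm⟩ | ⟨rfl, hdm⟩ | ⟨j, rfl, hj1, hj2, hdm⟩
  · omega
  · omega
  · have hi0 := hi.resolve_left (by rintro ⟨rfl, h0⟩; omega)
    refine pairCard_ne_of_lostVerts (hx.degree_le (d := 4) (by norm_num) fun m => ?_) hu.symm
      ht.symm hi0.1 (mem_lostVerts.2 ⟨by omega, Or.inr (Or.inl rfl)⟩)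
      (hx.mem_lostVerts_zero (by omega) _) (t := x (ν - 1)) (fun v hv => ?_) h
    · have := hd m
      omega
    · obtain ⟨m, rfl, hm, hmc⟩ := hx.exists_of_mem_lostVerts (by norm_num) hv
      have hdm := hd m
      have : m = ν - 1 := by omega
      rw [this]
  · have hdj := hd j
    obtain ⟨l, hl, hlw⟩ := hx.exists_leaf_ne (i := i) (by omega) w
    have := hx.eq_of_pairCard_eq_of_leaf hν2 (by omega) ht hl hlw h
    rcases this with ⟨h1, h2⟩ | ⟨h1, h2⟩
    · have := hd (ν + 2)
      rw [h2] at hdm hdj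
      omega
    · omega

theorem numCommonCards_S0a (hx : IsPeriodicSun G 2 k x w) (hk : 3 ≤ k)
    (hd : ∀ i, i % 2 = 0 ∧ G.degree (x i) = 3 ∨ i % 2 ≠ 0 ∧ G.degree (x i) = 2)
    (hν : ν % 2 = 1) (hU : Nonempty (card G w ≃g U)) (hT : Nonempty (card G (x ν) ≃g T)) :
    numCommonCards U T = k + 2 := by
  obtain ⟨l, hl, hli⟩ := hx.exists_leaf_family
  have hν2 : G.degree (x ν) = 2 := by have := hd ν; omega
  have h1 : G.degree (x 1) = 2 := by have := hd 1; omega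
  have hodd : ∀ {i j : ℤ}, x i = x j → (2 : ℤ) ∣ j - i := fun h => hx.dvd_of_eq h
  -- The cycle has length 2k ≥ 6, which does not divide 4.
  have hne : x 2 ≠ x (-2) := by
    intro h
    have h2 := ((hx.sun.eq_iff _ _).1 h).dvd
    have := Int.eq_zero_of_abs_lt_dvd h2 (by norm_num; omega)
    omega
  -- All k leaves other than none are used on the T side, along with both neighbours of `x ν`; these
  -- T-side endpoints form the cover.
  rw [numCommonCards_eq hU hT
    (fun j : Fin k ⊕ Bool =>
      j.elim (fun j : Fin k => x (ν - (2 : ℕ) * j)) fun b => if b then x 2 else x (-2))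
    (fun j => j.elim l fun b => if b then x (ν + 1) else x (ν - 1)) ?_ ?_ ?_ ?_ ?_
    (fun _ => False)]
  · simp
  · intro u t hu ht h
    simp only [and_false, not_false_eq_true, and_true, false_or]
    obtain ⟨i, rfl, d, hi, hcase⟩ := hx.cases_of_pairCard_eq hν2 hu ht h
    rcases hcase with ⟨m, hm, hm', hdm⟩ | ⟨rfl, hdm⟩ | ⟨rfl, hdm⟩ | ⟨j, rfl, hj1, hj2, hdm⟩
    · have hdm := hd m
      obtain ⟨j, hj⟩ := hx.exists_sub_eq' (a := 0) (i := m) (by omega)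
      rw [sub_zero] at hj
      have hlj := hl j
      rw [hj] at hlj
      exact ⟨Sum.inl j, hx.leaf_unique (by omega) hlj hm⟩
    · exact ⟨Sum.inr true, rfl⟩
    · exact ⟨Sum.inr false, rfl⟩
    · exfalso
      have hdi := hd i
      have hdj := hd j
      have hd0 := hd 0
      have hi0 := hi.resolve_left (by rintro ⟨rfl, h0⟩; omega)
      obtain ⟨l, hl⟩ := hx.exists_leaf (i := i) (by omega)
      have hlw : l ≠ w := by
        rintro rfl
        exact hi0.1 (hl.unique hx.leaf)
      have h2 := hd (ν + 1)
      have h3 := hd (ν - 1)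
      rcases hx.eq_of_pairCard_eq_of_leaf hν2 (by omega) ht hl hlw h with h4 | h4 <;> omega
  · rintro (j | b)
    · exact hx.ne_of_leafAt hx.leaf _
    · cases b <;> exact hx.ne_of_leafAt hx.leaf _
  · rintro (j | b)
    · exact (hx.ne_of_leafAt (hl j) _).symm
    · cases b
      · exact (hx.sun.adj_pred ν).ne'
      · exact (hx.sun.adj_succ ν).ne'
  · have h2 : ∀ (j : Fin k) (b : Bool), x (ν - (2 : ℕ) * j) ≠ if b then x 2 else x (-2) := by
      intro j b h
      cases b
      · have := hodd h
        omega
      · have := hodd h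
        omega
    rintro (i | b) (j | b') h
    · exact congrArg Sum.inl (hx.injective_sub ν h)
    · exact absurd h (h2 _ _)
    · exact absurd h.symm (h2 _ _)
    · cases b <;> cases b'
      · rfl
      · exact absurd h.symm hne
      · exact absurd h hne
      · rfl
  · have h2 : ∀ (j : Fin k) (b : Bool), l j ≠ if b then x (ν + 1) else x (ν - 1) := by
      intro j b h
      cases b <;> exact hx.ne_of_leafAt (hl j) _ h.symm
    rintro (i | b) (j | b') h
    · exact congrArg Sum.inl (hli h)
    · exact absurd h (h2 _ _)
    · exact absurd h.symm (h2 _ _)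
    · cases b <;> cases b'
      · rfl
      · exact absurd h.symm (hx.sun.succ_ne_pred ν)
      · exact absurd h (hx.sun.succ_ne_pred ν)
      · rfl
  · rintro (j | b)
    · exact hx.pairCard_sub (dvd_mul_right _ _) (hl j) ν
    · cases b
      · change pairCard G w (x (-2)) = pairCard G (x ν) (x (ν - 1))
        rw [hx.pairCard_neg_two h1, hx.pairCard_rotate (s := ν + 1) (by omega)]
        ring_nf
      · change pairCard G w (x 2) = pairCard G (x ν) (x (ν + 1))
        rw [hx.pairCard_two h1, hx.pairCard_rotate (s := ν - 1) (by omega)]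
        ring_nf

theorem numCommonCards_S1a (hx : IsPeriodicSun G 3 k x w)
    (hd : ∀ i, i % 3 = 0 ∧ G.degree (x i) = 3 ∨ i % 3 ≠ 0 ∧ G.degree (x i) = 2)
    (hν : ν % 3 = 1) (hU : Nonempty (card G w ≃g U)) (hT : Nonempty (card G (x ν) ≃g T)) :
    numCommonCards U T = k + 1 := by
  obtain ⟨l, hl, hli⟩ := hx.exists_leaf_family
  have hν2 : G.degree (x ν) = 2 := by have := hd ν; omega
  have h1 : G.degree (x 1) = 2 := by have := hd 1; omega
  have hmod : ∀ {i j : ℤ}, x i = x j → (3 : ℤ) ∣ j - i := fun h => hx.dvd_of_eq h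
  rw [numCommonCards_eq hU hT
    (fun j : Option (Fin k) => j.elim (x 2) (fun j => x (ν - (3 : ℕ) * j)))
    (fun j => j.elim (x (ν + 1)) l) ?_ ?_ ?_ ?_ ?_ (fun _ => False)]
  · simp
  · intro u t hu ht h
    simp only [and_false, not_false_eq_true, and_true, false_or]
    obtain ⟨i, rfl, d, hi, hcase⟩ := hx.cases_of_pairCard_eq hν2 hu ht h
    have hdi := hd i
    have hd0 := hd 0
    have h2 := hd (ν + 1)
    have h3 := hd (ν - 1)
    rcases hcase with ⟨m, hm, hm', hdm⟩ | ⟨rfl, hdm⟩ | ⟨rfl, hdm⟩ | ⟨j, rfl, hj1, hj2, hdm⟩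
    · have hdm := hd m
      obtain ⟨j, hj⟩ := hx.exists_sub_eq' (a := 0) (i := m) (by omega)
      rw [sub_zero] at hj
      have hlj := hl j
      rw [hj] at hlj
      exact ⟨some j, hx.leaf_unique (by omega) hlj hm⟩
    · exact ⟨none, rfl⟩
    · exfalso
      have hi0 := hi.resolve_left (by rintro ⟨rfl, h0⟩; omega)
      refine pairCard_ne_of_lostVerts (hx.degree_le (d := 3) (by norm_num) fun m => ?_) hu.symm
        ht.symm hi0.1 (mem_lostVerts.2 ⟨by omega, Or.inr (Or.inl rfl)⟩)
        (hx.mem_lostVerts_zero (by omega) _) (t := x (ν - 1)) (fun v hv => ?_) h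
      · have := hd m
        omega
      · obtain ⟨m, rfl, hm, hmc⟩ := hx.exists_of_mem_lostVerts (by norm_num) hv
        have hdm := hd m
        have : m = ν - 1 := by omega
        rw [this]
    · exfalso
      have hdj := hd j
      have hi0 := hi.resolve_left (by rintro ⟨rfl, h0⟩; omega)
      obtain ⟨l, hl⟩ := hx.exists_leaf (i := i) (by omega)
      have hlw : l ≠ w := by
        rintro rfl
        exact hi0.1 (hl.unique hx.leaf)
      have h4 := hd (ν + 2)
      rcases hx.eq_of_pairCard_eq_of_leaf hν2 (by omega) ht hl hlw h with ⟨h5, h6⟩ | ⟨h5, h6⟩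
      · rw [h6] at hdj hdm
        omega
      · omega
  · rintro (_ | j) <;> exact hx.ne_of_leafAt hx.leaf _
  · rintro (_ | j)
    · exact (hx.sun.adj_succ ν).ne'
    · exact (hx.ne_of_leafAt (hl j) _).symm
  · have h2 : ∀ j : Fin k, x (ν - (3 : ℕ) * j) ≠ x 2 := by
      intro j h
      have := hmod h
      omega
    rintro (_ | i) (_ | j) h
    · rfl
    · exact absurd h.symm (h2 _)
    · exact absurd h (h2 _)
    · exact congrArg some (hx.injective_sub ν h)
  · rintro (_ | i) (_ | j) h
    · rfl
    · exact absurd h (hx.ne_of_leafAt (hl j) _)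
    · exact absurd h.symm (hx.ne_of_leafAt (hl i) _)
    · exact congrArg some (hli h)
  · rintro (_ | j)
    · change pairCard G w (x 2) = pairCard G (x ν) (x (ν + 1))
      -- Reflect `x 2` to `x (-2)`, trade w for its twin `x (-1)`, and rotate by ν + 2, a multiple
      -- of 3. The twin pair at `x 1`, `x 2` itself cannot be rotated this way to start at `x ν`
      -- with the same orientation.
      rw [hx.pairCard_neg, hx.pairCard_neg_two h1, pairCard_comm,
        hx.pairCard_rotate (s := ν + 2) (by omega)]
      ring_nf
    · exact hx.pairCard_sub (dvd_mul_right _ _) (hl j) ν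

theorem numCommonCards_S0b (hx : IsPeriodicSun G 4 k x w)
    (hd : ∀ i, i % 4 = 0 ∧ G.degree (x i) = 4 ∨ i % 4 = 2 ∧ G.degree (x i) = 3 ∨
      i % 2 = 1 ∧ G.degree (x i) = 2)
    (hν : ν % 4 = 1) (hU : Nonempty (card G w ≃g U)) (hT : Nonempty (card G (x ν) ≃g T)) :
    numCommonCards U T = k * 2 + 1 := by
  have hd0 := hd 0
  obtain ⟨l, hl, hli⟩ := hx.exists_two_leaf_family (by omega)
  have hν2 : G.degree (x ν) = 2 := by have := hd ν; omega
  have h1 : G.degree (x 1) = 2 := by have := hd 1; omega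
  have hmod : ∀ {i j : ℤ}, x i = x j → (4 : ℤ) ∣ j - i := fun h => hx.dvd_of_eq h
  -- A mixed cover: the odd cycle positions on the U side, and for the extra pair its T-side
  -- endpoint `x (ν + 1)`.
  rw [numCommonCards_eq hU hT
    (fun j : Option (Fin k × Bool) => j.elim (x 2) (twoSided 4 x ν))
    (fun j => j.elim (x (ν + 1)) l) ?_ ?_ ?_ ?_ ?_ (fun j => j ≠ none)]
  · simp
  · intro u t hu ht h
    obtain ⟨i, rfl, d, hi, hcase⟩ := hx.cases_of_pairCard_eq hν2 hu ht h
    have hdi := hd i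
    by_cases hodd : i % 2 = 1
    · obtain ⟨j, hj⟩ := hx.exists_twoSided_eq (ν := ν) (i := i) (by omega)
      exact ⟨some j, Or.inl ⟨hj, by simp⟩⟩
    by_cases ht1 : t = x (ν + 1)
    · exact ⟨none, Or.inr ⟨ht1.symm, by simp⟩⟩
    exfalso
    have h2 := hd (ν + 1)
    have h3 := hd (ν - 1)
    have hdeg : ∀ m, G.degree (x m) ≤ 4 := fun m => by
      have := hd m
      omega
    rcases hcase with ⟨m, hm, hm', hdm⟩ | ⟨rfl, hdm⟩ | ⟨rfl, hdm⟩ | ⟨j, rfl, hj1, hj2, hdm⟩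
    · omega
    · exact ht1 rfl
    · have hi0 := hi.resolve_left (by rintro ⟨rfl, h0⟩; omega)
      refine pairCard_ne_of_lostVerts (hx.degree_le (by norm_num) hdeg) hu.symm
        ht.symm hi0.1 (mem_lostVerts.2 ⟨by omega, Or.inr (Or.inl rfl)⟩)
        (hx.mem_lostVerts_zero (by omega) _) (t := x (ν - 1)) (fun v hv => ?_) h
      obtain ⟨m, rfl, hm, hmc⟩ := hx.exists_of_mem_lostVerts (by norm_num) hv
      have hdm := hd m
      have : m = ν - 1 := by omega
      rw [this]
    · have hdj := hd j
      by_cases hj : G.degree (x j) = 2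
      · have hlw : ∃ l, LeafAt G l (x i) ∧ l ≠ w := by
          rcases hi with ⟨rfl, hi⟩ | ⟨hi0, hi⟩
          · exact hx.exists_leaf_ne (by omega) w
          · obtain ⟨l, hl⟩ := hx.exists_leaf (i := i) (by omega)
            refine ⟨l, hl, ?_⟩
            rintro rfl
            exact hi0 (hl.unique hx.leaf)
        obtain ⟨l, hl, hlw⟩ := hlw
        rcases hx.eq_of_pairCard_eq_of_leaf hν2 hj ht hl hlw h with h5 | h5 <;> omega
      · have hi0 := hi.resolve_left (by rintro ⟨rfl, h0⟩; omega)
        refine pairCard_ne_of_lostVerts (hx.degree_le (by norm_num) hdeg) hu.symm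
          ht.symm hi0.1 (mem_lostVerts.2 ⟨by omega, Or.inr (Or.inl rfl)⟩)
          (hx.mem_lostVerts_zero (by omega) _) (t := x (ν - 1)) (fun v hv => ?_) h
        obtain ⟨m, rfl, hm, hmc⟩ := hx.exists_of_mem_lostVerts (by norm_num) hv
        have hdm := hd m
        have : m = ν - 1 := by omega
        rw [this]
  · rintro (_ | j)
    · exact hx.ne_of_leafAt hx.leaf _
    · exact hx.twoSided_ne j
  · rintro (_ | j)
    · exact (hx.sun.adj_succ ν).ne'
    · exact (hx.ne_of_leafAt (hl j) _).symm
  · have h2 : ∀ j : Fin k × Bool, twoSided 4 x ν j ≠ x 2 := by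
      rintro ⟨j, b⟩ h
      cases b <;> simp only [twoSided, if_true, Bool.false_eq_true, if_false] at h
      · have := hmod h
        omega
      · have := hmod h
        omega
    rintro (_ | i) (_ | j) h
    · rfl
    · exact absurd h.symm (h2 _)
    · exact absurd h (h2 _)
    · exact congrArg some (hx.twoSided_injective (by omega) h)
  · rintro (_ | i) (_ | j) h
    · rfl
    · exact absurd h (hx.ne_of_leafAt (hl j) _)
    · exact absurd h.symm (hx.ne_of_leafAt (hl i) _)
    · exact congrArg some (hli h)
  · rintro (_ | j)
    · change pairCard G w (x 2) = pairCard G (x ν) (x (ν + 1))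
      rw [hx.pairCard_two h1, hx.pairCard_rotate (s := ν - 1) (by omega)]
      ring_nf
    · exact hx.pairCard_twoSided hl j

end IsPeriodicSun

/-! ### Structures with `x ν` at distance two from the nearest leaf-bearing vertex -/

namespace IsPeriodicSun

variable {V : Type u} [Fintype V] {G : SimpleGraph V} [DecidableRel G.Adj]
  {p k : ℕ} {x : ℤ → V} {w : V} {ν : ℤ}
  {VU VT : Type u} [Fintype VU] [Fintype VT] {U : SimpleGraph VU} {T : SimpleGraph VT}

theorem neg (hx : IsPeriodicSun G p k x w) : IsPeriodicSun G p k (fun i => x (-i)) w where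
  sun := hx.sun.neg
  leaf := hx.leaf
  degree_add i s hs := by
    rw [neg_add]
    exact hx.degree_add _ _ (dvd_neg.2 hs)
  degree_neg i := hx.degree_neg (-i)

theorem dvd_of_adj (hx : IsPeriodicSun G p k x w) {i j : ℤ} (h : G.Adj (x i) (x j)) :
    (p : ℤ) ∣ j - i - 1 ∨ (p : ℤ) ∣ j - i + 1 := by
  rcases hx.sun.eq_of_adj h with h | h
  · left
    rw [show j - i - 1 = -(i + 1 - j) by ring]
    exact dvd_neg.2 (hx.dvd_of_eq h)
  · right
    rw [show j - i + 1 = -(i - 1 - j) by ring]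
    exact dvd_neg.2 (hx.dvd_of_eq h)

variable [DecidableEq V]

theorem pairDeg_cycle (hx : IsPeriodicSun G p k x w) (i m : ℤ) :
    pairDeg G w (x i) (x m) + (if x m = x 0 then 1 else 0) +
      (if G.Adj (x m) (x i) then 1 else 0) = G.degree (x m) := by
  rw [← pairDeg_add (hx.ne_of_leafAt hx.leaf i).symm]
  simp only [G.adj_comm (x m) w, hx.leaf (x m)]

/-- In the two-deleted graph, there are two vertices of degree two with a leaf. -/
theorem exists_two_ends (hx : IsPeriodicSun G 4 k x w) (hk : 3 ≤ k)
    (hd : ∀ i, i % 4 = 0 ∧ G.degree (x i) = 3 ∨ i % 4 ≠ 0 ∧ G.degree (x i) = 2)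
    {i : ℤ} (hi : i = 0 ∨ i % 4 = 1) :
    ∃ a b y z, a ≠ b ∧ (a ≠ w ∧ a ≠ x i ∧ pairDeg G w (x i) a = 2) ∧
      (b ≠ w ∧ b ≠ x i ∧ pairDeg G w (x i) b = 2) ∧
      (y ≠ w ∧ y ≠ x i ∧ pairDeg G w (x i) y = 1) ∧
      (z ≠ w ∧ z ≠ x i ∧ pairDeg G w (x i) z = 1) ∧ G.Adj a y ∧ G.Adj b z := by
  have hmod : ∀ {i j : ℤ}, x i = x j → (4 : ℤ) ∣ j - i := fun h => hx.dvd_of_eq h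
  have hadj : ∀ {i j : ℤ}, G.Adj (x i) (x j) → (4 : ℤ) ∣ j - i - 1 ∨ (4 : ℤ) ∣ j - i + 1 :=
    fun h => hx.dvd_of_adj h
  have hw : ∀ i, x i ≠ w := hx.ne_of_leafAt hx.leaf
  have hne : ∀ j, x (j + 2) ≠ x (j - 2) := by
    intro j h
    have h2 := ((hx.sun.eq_iff _ _).1 h).dvd
    rw [show j - 2 - (j + 2) = -4 by ring] at h2
    have := Int.eq_zero_of_abs_lt_dvd h2 (by norm_num; omega)
    omega
  have inner : ∀ m, m % 4 ≠ 0 → ¬ G.Adj (x m) (x i) → pairDeg G w (x i) (x m) = 2 := by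
    intro m hm h
    have h1 := hx.pairDeg_cycle i m
    have h2 : x m ≠ x 0 := fun h2 => by
      have := hmod h2
      omega
    rw [if_neg h2, if_neg h] at h1
    have := hd m
    omega
  have outer : ∀ m, m % 4 ≠ 0 → G.Adj (x m) (x i) → pairDeg G w (x i) (x m) = 1 := by
    intro m hm h
    have h1 := hx.pairDeg_cycle i m
    have h2 : x m ≠ x 0 := fun h2 => by
      have := hmod h2
      omega
    rw [if_neg h2, if_pos h] at h1
    have := hd m
    omega
  have hne' : ∀ m, (m - i) % 4 ≠ 0 → x m ≠ x i := by
    intro m hm h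
    have := hmod h
    omega
  have hp1 : G.Adj (x (i + 1)) (x i) := (hx.sun.adj_succ i).symm
  have hp2 : G.Adj (x (i - 1)) (x i) := (hx.sun.adj_pred i).symm
  have hp3 : G.Adj (x (i + 2)) (x (i + 1)) := by
    have := (hx.sun.adj_succ (i + 1)).symm
    rwa [add_assoc] at this
  have hp4 : G.Adj (x (i - 2)) (x (i - 1)) := by
    have := (hx.sun.adj_pred (i - 1)).symm
    rwa [sub_sub] at this
  have hq1 : ¬ G.Adj (x (i + 2)) (x i) := fun h => by
    have := hadj h
    omega
  have hq2 : ¬ G.Adj (x (i - 2)) (x i) := fun h => by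
    have := hadj h
    omega
  -- One end is always `x (i + 1)`, next to `x (i + 2)`. If `x (i - 1)` drops to degree one, it is
  -- the other end; otherwise it keeps its leaf and drops to degree two.
  by_cases hc : i = 0 ∨ x (i - 1) = x 0
  · have hz : pairDeg G w (x i) (x (i - 1)) = 1 := by
      rcases hc with rfl | hc
      · exact outer _ (by omega) hp2
      · have h1 := hx.pairDeg_cycle i (i - 1)
        rw [if_pos hc, if_pos hp2, hc] at h1
        have := hd 0
        rw [hc]
        omega
    exact ⟨x (i + 2), x (i - 2), x (i + 1), x (i - 1), hne i,
      ⟨hw _, hne' _ (by omega), inner _ (by omega) hq1⟩,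
      ⟨hw _, hne' _ (by omega), inner _ (by omega) hq2⟩,
      ⟨hw _, hne' _ (by omega), outer _ (by omega) hp1⟩,
      ⟨hw _, hne' _ (by omega), hz⟩, hp3, hp4⟩
  · rw [not_or] at hc
    have hdi := hd (i - 1)
    obtain ⟨l, hl⟩ := hx.exists_leaf (i := i - 1) (by omega)
    have hlw : l ≠ w := by
      rintro rfl
      exact hc.2 (hl.unique hx.leaf)
    have hb : pairDeg G w (x i) (x (i - 1)) = 2 := by
      have h1 := hx.pairDeg_cycle i (i - 1)
      rw [if_neg hc.2, if_pos hp2] at h1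
      omega
    have hy : pairDeg G w (x i) l = 1 := by
      have h1 := pairDeg_add (hw i).symm l (G := G)
      rw [hl.degree, if_neg, if_neg] at h1
      · omega
      · rw [hl]
        exact fun h => hne' (i - 1) (by omega) h.symm
      · rw [hl]
        exact fun h => hw _ h.symm
    exact ⟨x (i + 2), x (i - 1), x (i + 1), l, fun h => by have := hmod h; omega,
      ⟨hw _, hne' _ (by omega), inner _ (by omega) hq1⟩,
      ⟨hw _, hne' _ (by omega), hb⟩,
      ⟨hw _, hne' _ (by omega), outer _ (by omega) hp1⟩,
      ⟨hlw, (hx.ne_of_leafAt hl i).symm, hy⟩, hp3, hl.adj.symm⟩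

/-- Deleting `x ν` and a vertex `t` whose only other neighbour has degree three creates at most
one vertex of degree two with a leaf, namely that neighbour. -/
theorem eq_of_end (hx : IsPeriodicSun G 4 k x w)
    (hd : ∀ i, i % 4 = 0 ∧ G.degree (x i) = 3 ∨ i % 4 ≠ 0 ∧ G.degree (x i) = 2)
    (hν : ν % 4 = 2) {t : V} (htν : t ≠ x ν) {m : ℤ} (hm : m % 4 = 0)
    (ht : ∀ v, v ≠ x ν → (G.Adj v t ↔ v = x m)) {a y : V} (ha : a ≠ x ν)
    (ha2 : pairDeg G (x ν) t a = 2) (hy : y ≠ x ν) (hy1 : pairDeg G (x ν) t y = 1)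
    (hay : G.Adj a y) : a = x m := by
  have hmod : ∀ {i j : ℤ}, x i = x j → (4 : ℤ) ∣ j - i := fun h => hx.dvd_of_eq h
  have hadj : ∀ {i j : ℤ}, G.Adj (x i) (x j) → (4 : ℤ) ∣ j - i - 1 ∨ (4 : ℤ) ∣ j - i + 1 :=
    fun h => hx.dvd_of_adj h
  -- At an index divisible by 4 the degree is three and `x ν` is not adjacent, so degree two after
  -- the deletion means that t was a neighbour.
  have key : ∀ j, a = x j → j % 4 = 0 → a = x m := by
    rintro j rfl hj
    have h1 := pairDeg_add htν.symm (x j) (G := G)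
    have h2 : ¬ G.Adj (x j) (x ν) := fun h => by
      have := hadj h
      omega
    rw [if_neg h2, ha2] at h1
    rw [← ht _ ha]
    by_contra h3
    rw [if_neg h3] at h1
    have := hd j
    omega
  have h1 := pairDeg_add htν.symm y (G := G)
  rw [hy1] at h1
  simp only [ht y hy] at h1
  -- A vertex y of degree one is either a neighbour of `x ν`, whose other neighbour is `x (ν + 2)`
  -- or `x (ν - 2)`, or an original leaf. Either way a has index divisible by 4.
  rcases hx.sun.cycle_or_leaf y with ⟨j, rfl⟩ | ⟨j, hj⟩
  · have hdj := hd j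
    have h4 : x j ≠ x m ∨ j % 4 = 0 := by
      by_cases h : x j = x m
      · have := hmod h
        right
        omega
      · exact Or.inl h
    have h5 : ¬ G.Adj (x j) (x ν) ∨ j % 4 ≠ 0 := by
      by_cases h : G.Adj (x j) (x ν)
      · have := hadj h
        right
        omega
      · exact Or.inl h
    by_cases h6 : G.Adj (x j) (x ν)
    · have hj2 : G.degree (x j) = 2 := by have := h5.resolve_left (not_not.2 h6); omega
      rcases hx.sun.eq_of_adj h6.symm with h | h
      · rw [h] at hj2 hay
        rcases (hx.adj_iff_of_degree_eq_two hj2 a).1 hay.symm with h7 | h7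
        · exact key _ h7 (by omega)
        · exact absurd (by rw [h7]; ring_nf) ha
      · rw [h] at hj2 hay
        rcases (hx.adj_iff_of_degree_eq_two hj2 a).1 hay.symm with h7 | h7
        · exact absurd (by rw [h7]; ring_nf) ha
        · exact key _ h7 (by omega)
    · rw [if_neg h6] at h1
      split_ifs at h1 with h7
      · have := h4.resolve_left (not_not.2 h7)
        omega
      · omega
  · have := hx.three_le_degree hj
    have hdj := hd j
    exact key j ((hj a).1 hay.symm) (by omega)

theorem numCommonCards_S2a (hx : IsPeriodicSun G 4 k x w) (hk : 3 ≤ k)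
    (hd : ∀ i, i % 4 = 0 ∧ G.degree (x i) = 3 ∨ i % 4 ≠ 0 ∧ G.degree (x i) = 2)
    (hν : ν % 4 = 2) (hU : Nonempty (card G w ≃g U)) (hT : Nonempty (card G (x ν) ≃g T)) :
    numCommonCards U T = k := by
  refine hx.numCommonCards_eq_of_rotations hU hT ?_
  intro u t hu ht h
  have hν2 : G.degree (x ν) = 2 := by have := hd ν; omega
  obtain ⟨i, rfl, d, hi, hcase⟩ := hx.cases_of_pairCard_eq hν2 hu ht h
  refine ⟨i, rfl, ?_⟩
  by_contra hi3
  have hdi := hd i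
  have hd0 := hd 0
  have hd1 := hd (ν + 1)
  have hd2 := hd (ν - 1)
  -- Up to reflection i is 0 or ≡ 1 modulo 4, so the U side has two degree-two vertices with a leaf,
  -- while the T side has at most one, `x m`.
  have main : d = 2 → ∀ m : ℤ, m % 4 = 0 → (∀ v, v ≠ x ν → (G.Adj v t ↔ v = x m)) → False := by
    intro hd' m hm htm
    obtain ⟨i', hi', h'⟩ : ∃ i', (i' = 0 ∨ i' % 4 = 1) ∧
        pairCard G w (x i') = pairCard G (x ν) t := by
      rcases hi with ⟨hi, -⟩ | ⟨-, hi⟩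
      · exact ⟨i, Or.inl hi, h⟩
      · by_cases hi1 : i % 4 = 1
        · exact ⟨i, Or.inr hi1, h⟩
        · exact ⟨-i, Or.inr (by omega), by rw [← hx.pairCard_neg, h]⟩
    obtain ⟨a, b, y, z, hab, ⟨ha1, ha2, ha3⟩, ⟨hb1, hb2, hb3⟩, ⟨hy1, hy2, hy3⟩, ⟨hz1, hz2, hz3⟩,
      hay, hbz⟩ := hx.exists_two_ends hk hd hi'
    obtain ⟨φ, f1, f2, f3, -⟩ := exists_of_pairCard_eq h'
    have e1 := hx.eq_of_end hd hν ht hm htm (f1 a ha1 ha2).1 ((f1 a ha1 ha2).2.2.trans ha3)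
      (f1 y hy1 hy2).1 ((f1 y hy1 hy2).2.2.trans hy3) ((f2 a y ha1 ha2 hy1 hy2).2 hay)
    have e2 := hx.eq_of_end hd hν ht hm htm (f1 b hb1 hb2).1 ((f1 b hb1 hb2).2.2.trans hb3)
      (f1 z hz1 hz2).1 ((f1 z hz1 hz2).2.2.trans hz3) ((f2 b z hb1 hb2 hz1 hz2).2 hbz)
    exact hab (f3 a b ha1 ha2 hb1 hb2 (e1.trans e2.symm))
  rcases hcase with ⟨m, hm, hm', hdm⟩ | ⟨rfl, hdm⟩ | ⟨rfl, hdm⟩ | ⟨j, rfl, hj1, hj2, hdm⟩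
  · have := hd m
    exact main hdm m (by omega) fun v _ => by rw [G.adj_comm, hm v]
  · refine main (by omega) (ν + 2) (by omega) fun v hv => ?_
    rw [G.adj_comm, hx.adj_iff_of_degree_eq_two (by omega), add_sub_cancel_right, add_assoc]
    norm_num [hv]
  · refine main (by omega) (ν - 2) (by omega) fun v hv => ?_
    rw [G.adj_comm, hx.adj_iff_of_degree_eq_two (by omega), sub_add_cancel, sub_sub]
    norm_num [hv]
  · have hdj := hd j
    have hi0 := hi.resolve_left (by rintro ⟨rfl, h0⟩; omega)
    obtain ⟨l, hl⟩ := hx.exists_leaf (i := i) (by omega)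
    have hlw : l ≠ w := by
      rintro rfl
      exact hi0.1 (hl.unique hx.leaf)
    have h4 := hd (ν + 2)
    have h5 := hd (ν - 2)
    rcases hx.eq_of_pairCard_eq_of_leaf hν2 (by omega) ht hl hlw h with ⟨-, h6⟩ | ⟨-, h6⟩ <;>
    · rw [h6] at hdj hdm
      omega

/-- Deleting `w` and `x 0` or `x 1` leaves no vertex of degree three. -/
theorem pairDeg_ne_three (hx : IsPeriodicSun G 5 k x w)
    (hd : ∀ i, i % 5 = 0 ∧ G.degree (x i) = 4 ∨ i % 5 ≠ 0 ∧ G.degree (x i) = 2)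
    {i : ℤ} (hi : i = 0 ∨ x (i - 1) = x 0) {v : V} (hv : v ≠ x i) :
    pairDeg G w (x i) v ≠ 3 := by
  intro h3
  have hmod : ∀ {i j : ℤ}, x i = x j → (5 : ℤ) ∣ j - i := fun h => hx.dvd_of_eq h
  rcases hx.sun.cycle_or_leaf v with ⟨m, rfl⟩ | ⟨m, hm⟩
  · have h1 := hx.pairDeg_cycle i m
    have hdm := hd m
    rcases hi with rfl | hi
    · rw [if_neg hv] at h1
      split_ifs at h1 with h4
      · have := hx.dvd_of_adj h4
        push_cast at this
        omega
      · omega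
    · have hi5 := hmod hi
      by_cases h0 : x m = x 0
      · rw [if_pos h0, h0, if_pos] at h1
        · have := hd 0
          rw [h0] at h3
          omega
        · rw [← hi]
          exact (hx.sun.adj_pred i).symm
      · rw [if_neg h0, if_neg] at h1
        · omega
        · intro h4
          rcases hx.sun.eq_of_adj h4.symm with h5 | h5
          · have := hmod h5
            omega
          · exact h0 (h5.trans hi)
  · have h1 := pairDeg_add (hx.ne_of_leafAt hx.leaf i).symm v (G := G)
    rw [hm.degree] at h1
    omega

theorem numCommonCards_S2b_aux (hx : IsPeriodicSun G 5 k x w)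
    (hd : ∀ i, i % 5 = 0 ∧ G.degree (x i) = 4 ∨ i % 5 ≠ 0 ∧ G.degree (x i) = 2)
    (hν : ν % 5 = 2) (hU : Nonempty (card G w ≃g U)) (hT : Nonempty (card G (x ν) ≃g T)) :
    numCommonCards U T = k * 2 := by
  have hd0 : G.degree (x 0) = 4 := by have := hd 0; omega
  refine hx.numCommonCards_eq_of_dihedral hd0 (by omega) hU hT ?_
  intro u t hu ht h
  have hν2 : G.degree (x ν) = 2 := by have := hd ν; omega
  obtain ⟨i, rfl, d, hi, hcase⟩ := hx.cases_of_pairCard_eq hν2 hu ht h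
  refine ⟨i, rfl, ?_⟩
  by_contra hi3
  have hdi := hd i
  have hd1 := hd (ν + 1)
  have hd2 := hd (ν - 1)
  have hadj : ∀ {i j : ℤ}, G.Adj (x i) (x j) → (5 : ℤ) ∣ j - i - 1 ∨ (5 : ℤ) ∣ j - i + 1 :=
    fun h => hx.dvd_of_adj h
  have hdeg : ∀ v, G.degree v ≤ 4 := hx.degree_le (by norm_num) fun m => by
    have := hd m
    omega
  -- Up to reflection i ≡ 1 modulo 5. The T side lowers only `x m` from degree four, to degree
  -- three. On the U side either `x (i' - 1)` and `x 0` are two distinct lost vertices, or they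
  -- coincide and no degree three arises.
  have main : d = 2 → ∀ m : ℤ, m % 5 = 0 → G.Adj (x m) t → x m ≠ t →
      (∀ v ∈ lostVerts G 4 (x ν) t, v = x m) → False := by
    intro hd' m hm hmt hmt' hlost
    have hex : ∃ i', i' % 5 = 1 ∧ pairCard G w (x i') = pairCard G (x ν) t := by
      by_cases hi1 : i % 5 = 1
      · exact ⟨i, hi1, h⟩
      · have hi4 : (-i) % 5 = 1 := by omega
        exact ⟨-i, hi4, by rw [← hx.pairCard_neg, h]⟩
    obtain ⟨i', hi', h'⟩ := hex
    by_cases h0 : x (i' - 1) = x 0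
    · have h4 : pairDeg G (x ν) t (x m) = 3 := by
        have h1 := pairDeg_add ht.symm (x m) (G := G)
        rw [if_pos hmt, if_neg] at h1
        · have := hd m
          omega
        · intro h2
          have := hadj h2
          omega
      obtain ⟨v, h5, h6, h7⟩ := exists_pairDeg h'.symm (v := x m)
        (fun h2 => by
          have h3 := hx.dvd_of_eq h2
          push_cast at h3
          omega) hmt'
      exact hx.pairDeg_ne_three hd (Or.inr h0) h6 (h7.trans h4)
    · have hdi' := hd (i' - 1)
      have hy : x (i' - 1) ∈ lostVerts G 4 w (x i') :=
        mem_lostVerts.2 ⟨by omega, Or.inr (Or.inr (Or.inr (hx.sun.adj_pred i').symm))⟩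
      exact pairCard_ne_of_lostVerts hdeg (hx.ne_of_leafAt hx.leaf _).symm ht.symm h0 hy
        (hx.mem_lostVerts_zero hd0 _) hlost h'
  rcases hcase with ⟨m, hm, hm', hdm⟩ | ⟨rfl, hdm⟩ | ⟨rfl, hdm⟩ | ⟨j, rfl, hj1, hj2, hdm⟩
  · have := hd m
    refine main hdm m (by omega) hm.adj.symm (hx.ne_of_leafAt hm m) fun v hv => ?_
    obtain ⟨m', rfl, hm1, hm2⟩ := hx.exists_of_mem_lostVerts_leaf (by norm_num) hm hv
    have := hd m'
    have : m' = m := by omega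
    rw [this]
  -- Deleting `x ν` and `x (ν + 1)` affects no vertex of degree four, whereas deleting w always
  -- lowers `x 0`.
  · have h1 := card_lostVerts_eq hdeg hu.symm ht.symm h
    have h2 : 0 < (lostVerts G 4 w (x i)).card :=
      Finset.card_pos.2 ⟨_, hx.mem_lostVerts_zero hd0 _⟩
    rw [h1] at h2
    obtain ⟨v, hv⟩ := Finset.card_pos.1 h2
    obtain ⟨m', rfl, hm1, hm2⟩ := hx.exists_of_mem_lostVerts (by norm_num) hv
    have := hd m'
    omega
  · have hadj2 : G.Adj (x (ν - 2)) (x (ν - 1)) := by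
      have := (hx.sun.adj_pred (ν - 1)).symm
      rwa [sub_sub] at this
    refine main (by omega) (ν - 2) (by omega) hadj2 hadj2.ne fun v hv => ?_
    obtain ⟨m', rfl, hm1, hm2⟩ := hx.exists_of_mem_lostVerts (by norm_num) hv
    have := hd m'
    have : m' = ν - 2 := by omega
    rw [this]
  · have hdj := hd j
    obtain ⟨rfl, hi⟩ := hi.resolve_right (by rintro ⟨-, h0⟩; omega)
    obtain ⟨l, hl, hlw⟩ := hx.exists_leaf_ne (i := 0) (by omega) w
    have h5 := hd (ν - 2)
    rcases hx.eq_of_pairCard_eq_of_leaf hν2 (by omega) ht hl hlw h with ⟨-, h6⟩ | ⟨-, h6⟩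
    -- Here `x (ν + 3)` drops from degree four to three, but deleting w and `x 0` leaves no vertex
    -- of degree three.
    · have hd3 := hd (ν + 3)
      have hadj3 : G.Adj (x (ν + 3)) (x j) := by
        rw [h6]
        have := (hx.sun.adj_succ (ν + 2)).symm
        rwa [add_assoc] at this
      have h4 : pairDeg G (x ν) (x j) (x (ν + 3)) = 3 := by
        have h1 := pairDeg_add ht.symm (x (ν + 3)) (G := G)
        rw [if_pos hadj3, if_neg] at h1
        · omega
        · intro h2
          have := hadj h2
          omega
      obtain ⟨v, -, h8, h7⟩ := exists_pairDeg h.symm (v := x (ν + 3))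
        (fun h2 => by
          have h3 := hx.dvd_of_eq h2
          push_cast at h3
          omega) hadj3.ne
      exact hx.pairDeg_ne_three hd (Or.inl rfl) h8 (h7.trans h4)
    · rw [h6] at hdj hdm
      omega

theorem numCommonCards_S2b (hx : IsPeriodicSun G 5 k x w)
    (hd : ∀ i, i % 5 = 0 ∧ G.degree (x i) = 4 ∨ i % 5 ≠ 0 ∧ G.degree (x i) = 2)
    (hν : ν % 5 = 2 ∨ ν % 5 = 3) (hU : Nonempty (card G w ≃g U))
    (hT : Nonempty (card G (x ν) ≃g T)) : numCommonCards U T = k * 2 := by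
  rcases hν with hν | hν
  · exact hx.numCommonCards_S2b_aux hd hν hU hT
  -- Reversing the cycle turns ν ≡ 3 into -ν ≡ 2 modulo 5.
  · refine hx.neg.numCommonCards_S2b_aux (ν := -ν) (fun i => ?_) (by omega) hU (by rwa [neg_neg])
    have := hd (-i)
    omega

end IsPeriodicSun

/-- A labelling whose degrees follow a symmetric pattern `g` of period `p` on `[0, c)`, when the
order of the graph forces `p` to divide `c`. -/
theorem IsLabelling.exists_isPeriodicSun {V : Type u} [Fintype V] {G : SimpleGraph V}
    [DecidableRel G.Adj] {w : V} {c : ℕ} {x : ℤ → V} {ν : ℤ} (hx : IsLabelling G w c x ν)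
    (hG : G.Connected) (p : ℕ) (hp : 0 < p) (g : ℤ → ℕ)
    (hg : ∀ i : ℤ, 0 ≤ i → i < c → G.degree (x i) = g i)
    (hadd : ∀ i s, (p : ℤ) ∣ s → g (i + s) = g i) (hneg : ∀ i, g (-i) = g i)
    (hcard : ∀ k r, r < p → Fintype.card V = k * ∑ i ∈ Finset.range p, (g (i : ℤ) - 1) +
      ∑ i ∈ Finset.range r, (g (i : ℤ) - 1) → r = 0) :
    ∃ k, IsPeriodicSun G p k x w ∧ (∀ i, G.degree (x i) = g i) ∧
      Fintype.card V = k * ∑ i ∈ Finset.range p, (g (i : ℤ) - 1) := by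
  classical
  have hsun := hx.isSun hG
  have h1 : Fintype.card V = c / p * ∑ i ∈ Finset.range p, (g (i : ℤ) - 1) +
      ∑ i ∈ Finset.range (c % p), (g (i : ℤ) - 1) := by
    rw [hsun.card_eq_sum, ← sum_range_periodic p (fun i => g (i : ℤ) - 1), Nat.div_add_mod]
    · refine Finset.sum_congr rfl fun i hi => ?_
      rw [hg i (by positivity) (by exact_mod_cast Finset.mem_range.1 hi)]
    · intro i
      push_cast
      rw [hadd _ _ dvd_rfl]
  have h2 := hcard _ _ (Nat.mod_lt _ hp) h1
  have h3 : p * (c / p) = c := by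
    have := Nat.div_add_mod c p
    omega
  have hc : (0 : ℤ) < c := by
    have := hx.three_le
    omega
  have hdeg : ∀ i, G.degree (x i) = g i := by
    intro i
    rw [(hx.eq_iff _ _).2 (Int.mod_modEq i c).symm,
      hg _ (Int.emod_nonneg _ hc.ne') (Int.emod_lt_of_pos _ hc), Int.emod_def, sub_eq_add_neg]
    refine hadd _ _ (dvd_neg.2 (dvd_mul_of_dvd_left ?_ _))
    exact_mod_cast Dvd.intro _ h3
  obtain ⟨l, hl⟩ := exists_leafAt hx.leaf
  have hw : LeafAt G w (x 0) := by rwa [(hl _).1 hx.adj_leaf.symm]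
  refine ⟨c / p, ⟨by rwa [h3], hw, fun i s hs => ?_, fun i => ?_⟩, hdeg, ?_⟩
  · rw [hdeg, hdeg, hadd _ _ hs]
  · rw [hdeg, hdeg, hneg]
  · rw [h1, h2]
    simp

end SunCat

/-! ### The six formulas -/

theorem mainTheorem6
    (n : ℕ) (hn : 14 ≤ n)
    -- a sunshine graph `U` and a caterpillar `T` of order `n`
    {VU VT VP : Type u} [Fintype VU] [Fintype VT] [Fintype VP]
    (U : SimpleGraph VU) [DecidableRel U.Adj]
    (T : SimpleGraph VT) [DecidableRel T.Adj]
    (hU : SunCat.IsSunshine U) (hUn : Fintype.card VU = n)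
    (hT : SunCat.IsCaterpillar T) (hTn : Fintype.card VT = n)
    -- a sunshine graph `UP` (written `U⁺`), labelled around its cycle, that is a supercard of
    -- `U` and `T`: the card of `w` is isomorphic to `U` and the card of `x ν` is isomorphic to `T`
    (UP : SimpleGraph VP) [DecidableRel UP.Adj] (hUP : SunCat.IsSunshine UP)
    (w : VP) (c : ℕ) (x : ℤ → VP) (ν : ℤ)
    (hx : SunCat.IsLabelling UP w c x ν)
    (hcardU : Nonempty (SunCat.card UP w ≃g U))
    (hcardT : Nonempty (SunCat.card UP (x ν) ≃g T)) :
    (SunCat.StructureS0a UP n c x ν →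
      (SunCat.numCommonCards U T : ℚ) = ((n : ℚ) + 1) / 3 + 2) ∧
    (SunCat.StructureS0b UP n c x ν →
      (SunCat.numCommonCards U T : ℚ) = 2 * ((n : ℚ) + 1) / 7 + 1) ∧
    (SunCat.StructureS1a UP n c x ν →
      (SunCat.numCommonCards U T : ℚ) = ((n : ℚ) + 1) / 4 + 1) ∧
    (SunCat.StructureS1b UP n c x ν →
      (SunCat.numCommonCards U T : ℚ) = 2 * ((n : ℚ) + 1) / 5) ∧
    (SunCat.StructureS2a UP n c x ν →
      (SunCat.numCommonCards U T : ℚ) = ((n : ℚ) + 1) / 5) ∧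
    (SunCat.StructureS2b UP n c x ν →
      (SunCat.numCommonCards U T : ℚ) = 2 * ((n : ℚ) + 1) / 7) := by
  classical
  have hcard : Fintype.card VP = n + 1 := by
    obtain ⟨e⟩ := hcardU
    have h := Fintype.card_congr e.toEquiv
    rw [Fintype.card_compl_set, hUn, Set.card_singleton] at h
    omega
  have hG := hUP.1
  refine ⟨?_, ?_, ?_, ?_, ?_, ?_⟩
  · rintro ⟨hmod, hdeg, hν⟩
    obtain ⟨k, hk, hd, hkn⟩ := hx.exists_isPeriodicSun hG 2 (by norm_num) _ hdeg
      (fun i s hs => by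
        push_cast at hs
        split_ifs <;> simp only [Int.ModEq] at * <;> omega)
      (fun i => by split_ifs <;> simp only [Int.ModEq] at * <;> omega)
      -- A period contributes 3 vertices and 3 ∣ n + 1, whereas a nonempty proper initial part of a
      -- period contributes a number strictly between 0 and 3.
      (fun k r hr h => by
        rw [hcard] at h
        simp only [Nat.ModEq] at hmod
        interval_cases r <;> simp [Finset.sum_range_succ, Int.ModEq] at h ⊢ <;> omega)
    simp only [Finset.sum_range_succ, Int.ModEq] at hkn
    norm_num [hcard] at hkn
    simp only [Int.ModEq] at hν
    rw [hk.numCommonCards_S0a (by omega) (fun i => by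
      have hdi := hd i
      split_ifs at hdi <;> simp only [Int.ModEq] at * <;> omega) (by omega) hcardU hcardT]
    have hq : (n : ℚ) + 1 = k * 3 := by exact_mod_cast hkn
    rw [hq]
    push_cast
    ring
  · rintro ⟨hmod, hdeg, hν⟩
    obtain ⟨k, hk, hd, hkn⟩ := hx.exists_isPeriodicSun hG 4 (by norm_num) _ hdeg
      (fun i s hs => by
        push_cast at hs
        split_ifs <;> simp only [Int.ModEq] at * <;> omega)
      (fun i => by split_ifs <;> simp only [Int.ModEq] at * <;> omega)
      (fun k r hr h => by
        rw [hcard] at h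
        simp only [Nat.ModEq] at hmod
        interval_cases r <;> simp [Finset.sum_range_succ, Int.ModEq] at h ⊢ <;> omega)
    simp only [Finset.sum_range_succ, Int.ModEq] at hkn
    norm_num [hcard] at hkn
    simp only [Int.ModEq] at hν
    rw [hk.numCommonCards_S0b (fun i => by
      have hdi := hd i
      split_ifs at hdi <;> simp only [Int.ModEq] at * <;> omega) (by omega) hcardU hcardT]
    have hq : (n : ℚ) + 1 = k * 7 := by exact_mod_cast hkn
    rw [hq]
    push_cast
    ring
  · rintro ⟨hmod, hdeg, hν⟩
    obtain ⟨k, hk, hd, hkn⟩ := hx.exists_isPeriodicSun hG 3 (by norm_num) _ hdeg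
      (fun i s hs => by
        push_cast at hs
        split_ifs <;> simp only [Int.ModEq] at * <;> omega)
      (fun i => by split_ifs <;> simp only [Int.ModEq] at * <;> omega)
      (fun k r hr h => by
        rw [hcard] at h
        simp only [Nat.ModEq] at hmod
        interval_cases r <;> simp [Finset.sum_range_succ, Int.ModEq] at h ⊢ <;> omega)
    simp only [Finset.sum_range_succ, Int.ModEq] at hkn
    norm_num [hcard] at hkn
    simp only [Int.ModEq] at hν
    rw [hk.numCommonCards_S1a (fun i => by
      have hdi := hd i
      split_ifs at hdi <;> simp only [Int.ModEq] at * <;> omega) (by omega) hcardU hcardT]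
    have hq : (n : ℚ) + 1 = k * 4 := by exact_mod_cast hkn
    rw [hq]
    push_cast
    ring
  · rintro ⟨hmod, hdeg, hν⟩
    obtain ⟨k, hk, hd, hkn⟩ := hx.exists_isPeriodicSun hG 3 (by norm_num) _ hdeg
      (fun i s hs => by
        push_cast at hs
        split_ifs <;> simp only [Int.ModEq] at * <;> omega)
      (fun i => by split_ifs <;> simp only [Int.ModEq] at * <;> omega)
      (fun k r hr h => by
        rw [hcard] at h
        simp only [Nat.ModEq] at hmod
        interval_cases r <;> simp [Finset.sum_range_succ, Int.ModEq] at h ⊢ <;> omega)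
    simp only [Finset.sum_range_succ, Int.ModEq] at hkn
    norm_num [hcard] at hkn
    simp only [Int.ModEq] at hν
    rw [hk.numCommonCards_S1b (fun i => by
      have hdi := hd i
      split_ifs at hdi <;> simp only [Int.ModEq] at * <;> omega) (by omega) hcardU hcardT]
    have hq : (n : ℚ) + 1 = k * 5 := by exact_mod_cast hkn
    rw [hq]
    push_cast
    ring
  · rintro ⟨hmod, hdeg, hν⟩
    obtain ⟨k, hk, hd, hkn⟩ := hx.exists_isPeriodicSun hG 4 (by norm_num) _ hdeg
      (fun i s hs => by
        push_cast at hs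
        split_ifs <;> simp only [Int.ModEq] at * <;> omega)
      (fun i => by split_ifs <;> simp only [Int.ModEq] at * <;> omega)
      (fun k r hr h => by
        rw [hcard] at h
        simp only [Nat.ModEq] at hmod
        interval_cases r <;> simp [Finset.sum_range_succ, Int.ModEq] at h ⊢ <;> omega)
    simp only [Finset.sum_range_succ, Int.ModEq] at hkn
    norm_num [hcard] at hkn
    simp only [Int.ModEq] at hν
    -- The bound n ≥ 14 gives 5k = n + 1 ≥ 15, hence k ≥ 3.
    rw [hk.numCommonCards_S2a (by omega) (fun i => by
      have hdi := hd i
      split_ifs at hdi <;> simp only [Int.ModEq] at * <;> omega) (by omega) hcardU hcardT]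
    have hq : (n : ℚ) + 1 = k * 5 := by exact_mod_cast hkn
    rw [hq]
    ring
  · rintro ⟨hmod, hdeg, hν⟩
    obtain ⟨k, hk, hd, hkn⟩ := hx.exists_isPeriodicSun hG 5 (by norm_num) _ hdeg
      (fun i s hs => by
        push_cast at hs
        split_ifs <;> simp only [Int.ModEq] at * <;> omega)
      (fun i => by split_ifs <;> simp only [Int.ModEq] at * <;> omega)
      (fun k r hr h => by
        rw [hcard] at h
        simp only [Nat.ModEq] at hmod
        interval_cases r <;> simp [Finset.sum_range_succ, Int.ModEq] at h ⊢ <;> omega)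
    simp only [Finset.sum_range_succ, Int.ModEq] at hkn
    norm_num [hcard] at hkn
    simp only [Int.ModEq] at hν
    rw [hk.numCommonCards_S2b (fun i => by
      have hdi := hd i
      split_ifs at hdi <;> simp only [Int.ModEq] at * <;> omega) (by omega) hcardU hcardT]
    have hq : (n : ℚ) + 1 = k * 7 := by exact_mod_cast hkn
    rw [hq]
    push_cast
    ring
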